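/- Let $n\ge 0$, let $S^n\subset\mathbb R^{n+1}$ be the unit sphere with its rotation invariant surface measure $d\omega$ (total mass $2\pi^{(n+1)/2}/\Gamma(\tfrac{n+1}2)$), and consider smooth complex valued functions on $S^n$. Throughout, $1/\Gamma$ is understood as an entire function, equal to $0$ at $0,-1,-2,\dots$. **Even functions.** For $f\in C^\infty(S^n)$ even, the integral $$(J_\lambda f)(\xi)=\int_{S^n} f(\omega)\,\frac{|\langle\xi,\omega\rangle|^\lambda}{\Gamma(\frac{\lambda+1}2)}\,d\omega$$ converges absolutely for $\operatorname{Re}\lambda>-1$ and, for each $\xi\in S^n$, extends to an entire function of $\lambda$; this defines $J_\lambda f$ for all $\lambda\in\mathbb C$. For every $\lambda\in\mathbb C$ the function $\varphi=J_\lambda f$ is again smooth and even, and $$J_{-\lambda-n-1}\varphi=c(\lambda)\,f,\qquad c(\lambda)=\frac{4\pi^n}{\Gamma(-\frac\lambda2)\,\Gamma(\frac{\lambda+n+1}2)} .$$ Consequently, if neither $\lambda$ nor $-\lambda-n-1$ belongs to $\{0,2,4,\dots\}$, then $\varphi=J_\lambda f$ implies $$f=c(\lambda)^{-1}J_{-\lambda-n-1}\varphi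 ,$$ that is, $f=J_{-\lambda-n-1}\varphi$ when the factor $c(\lambda)^{-1}$ is included in the normalization of the measure. **Odd functions.** For $f\in C^\infty(S^n)$ odd, the same holds for $$(J_\lambda f)(\xi)=\int_{S^n} f(\omega)\,\frac{|\langle\xi,\omega\rangle|^\lambda\operatorname{sign}\langle\xi,\omega\rangle}{\Gamma(\frac{\lambda+2}2)}\,d\omega :$$ the integral converges absolutely for $\operatorname{Re}\lambda>-1$ and extends to an entire function of $\lambda$ for each $\xi$; $\varphi=J_\lambda f$ is smooth and odd for all $\lambda\in\mathbb C$; one has $J_{-\lambda-n-1}\varphi=c_-(\lambda) f$ with $$c_-(\lambda)=\frac{4\pi^n}{\Gamma(\frac{1-\lambda}2)\,\Gamma(\frac{\lambda+n+2}2)} ;$$ and $f=c_-(\lambda)^{-1}J_{-\lambda-n-1}\varphi$ if neither $\lambda$ nor $-\lambda-n-1$ belongs to $\{1,3,5,\dots\}$. **Odd functions with the Gamma factor of the even case.** If $\Gamma(\frac{\lambda+1}2)$ is kept in the denominator, i.e. for $f$ smooth and odd and $$(J'_\lambda f)(\xi)=\int_{S^n} f(\omega)\,\frac{|\langle\xi,\omega\rangle|^\lambda\operatorname{sign}\langle\xi,\omega\rangle}{\Gamma(\frac{\lambda+1}2)}\,d\omega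 ,$$ then the integral converges absolutely for $\operatorname{Re}\lambda>-1$ and, for each $\xi$, extends holomorphically in $\lambda$ to $D=\mathbb C\setminus\{-2,-4,-6,\dots\}$; for $\lambda\in D$ the function $\varphi=J'_\lambda f$ is smooth and odd. If $\lambda$ and $\mu=-\lambda-n-1$ both lie in $D$, then $$J'_{\mu}\varphi=c'(\lambda) f,\qquad c'(\lambda)=\frac{\Gamma(\frac{\lambda+2}2)}{\Gamma(\frac{\lambda+1}2)}\,\frac{\Gamma(\frac{\mu+2}2)}{\Gamma(\frac{\mu+1}2)}\;c_-(\lambda),$$ and if moreover neither $\lambda$ nor $\mu$ is an odd integer, then $f=c'(\lambda)^{-1}J'_{-\lambda-n-1}\varphi$. -/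

import Mathlib

open MeasureTheory Metric
open scoped Manifold ContDiff InnerProductSpace

noncomputable section

/-- The unit sphere `S^n` in `ℝ^(n+1)`. -/
abbrev UnitSphere (n : ℕ) : Type := sphere (0 : EuclideanSpace ℝ (Fin (n + 1))) 1

/-- The rotation invariant surface measure on `S^n` (total mass `2 π^((n+1)/2) / Γ((n+1)/2)`). -/
def surfaceMeasure (n : ℕ) : Measure (UnitSphere n) :=
  (volume : Measure (EuclideanSpace ℝ (Fin (n + 1)))).toSphere

/-- Smooth (`C^∞`) complex valued functions on `S^n`. -/
def SmoothOnSphere (n : ℕ) (f : UnitSphere n → ℂ) : Prop :=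
  haveI : Fact (Module.finrank ℝ (EuclideanSpace ℝ (Fin (n + 1))) = n + 1) := ⟨by simp⟩
  ContMDiff (𝓡 n) 𝓘(ℝ, ℂ) ∞ f

/-- The kernel `|t|^z / Γ((z+1)/2)`. -/
def evenKernel (z : ℂ) (t : ℝ) : ℂ :=
  ((|t| : ℝ) : ℂ) ^ z / Complex.Gamma ((z + 1) / 2)

/-- The kernel `|t|^z sign t / Γ((z+2)/2)`. -/
def oddKernel (z : ℂ) (t : ℝ) : ℂ :=
  ((|t| : ℝ) : ℂ) ^ z * ((Real.sign t : ℝ) : ℂ) / Complex.Gamma ((z + 2) / 2)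

/-- The kernel `|t|^z sign t / Γ((z+1)/2)`: the sign is inserted and the Gamma factor of the
even kernel is kept. -/
def signedKernel (z : ℂ) (t : ℝ) : ℂ :=
  ((|t| : ℝ) : ℂ) ^ z * ((Real.sign t : ℝ) : ℂ) / Complex.Gamma ((z + 1) / 2)

/-- The integrand `f(η) K_z(⟨ξ, η⟩)`. -/
def sphereIntegrand (n : ℕ) (K : ℂ → ℝ → ℂ) (f : UnitSphere n → ℂ) (z : ℂ) (ξ η : UnitSphere n) :
    ℂ :=
  f η * K z ⟪(ξ : EuclideanSpace ℝ (Fin (n + 1))), (η : EuclideanSpace ℝ (Fin (n + 1)))⟫_ℝ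

/-- `∫_{S^n} f(η) K_z(⟨ξ, η⟩) dη`. -/
def sphereIntegral (n : ℕ) (K : ℂ → ℝ → ℂ) (f : UnitSphere n → ℂ) (z : ℂ) (ξ : UnitSphere n) : ℂ :=
  ∫ η, sphereIntegrand n K f z ξ η ∂(surfaceMeasure n)

/-- `G` is holomorphic on `U` and agrees with `g` on the half plane `Re z > -1`. -/
def IsContinuation (U : Set ℂ) (g G : ℂ → ℂ) : Prop :=
  DifferentiableOn ℂ G U ∧ ∀ z : ℂ, -1 < z.re → G z = g z

open Classical in
/-- The analytic continuation of `g` from `Re z > -1` to `U`. For `U` open, connected and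
containing that half plane it is unique on `U` if it exists; the junk value is `0`. -/
def continuation (U : Set ℂ) (g : ℂ → ℂ) : ℂ → ℂ :=
  if h : ∃ G : ℂ → ℂ, IsContinuation U g G then h.choose else 0

/-- The integral transform on `S^n` with the kernel `K_z(⟨ξ, η⟩)`, continued analytically in `z`
from `Re z > -1` to `U`. -/
def sphereTransform (n : ℕ) (K : ℂ → ℝ → ℂ) (U : Set ℂ) (z : ℂ) (f : UnitSphere n → ℂ)
    (ξ : UnitSphere n) : ℂ :=
  continuation U (fun w => sphereIntegral n K f w ξ) z

/-- For every `f`: the integral converges absolutely for `Re z > -1`, and the transform of `f` is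
its analytic continuation to `U`. -/
def TransformDefined (n : ℕ) (K : ℂ → ℝ → ℂ) (U : Set ℂ) (f : UnitSphere n → ℂ) : Prop :=
  ∀ ξ : UnitSphere n,
    (∀ z : ℂ, -1 < z.re → Integrable (sphereIntegrand n K f z ξ) (surfaceMeasure n)) ∧
    IsContinuation U (fun z => sphereIntegral n K f z ξ) (fun z => sphereTransform n K U z f ξ)

/-- `J_z` on even functions, for all complex `z`. -/
def evenJ (n : ℕ) (z : ℂ) (f : UnitSphere n → ℂ) : UnitSphere n → ℂ :=
  sphereTransform n evenKernel Set.univ z f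

/-- `J_z` on odd functions, for all complex `z`. -/
def oddJ (n : ℕ) (z : ℂ) (f : UnitSphere n → ℂ) : UnitSphere n → ℂ :=
  sphereTransform n oddKernel Set.univ z f

/-- The complex plane without `-2, -4, -6, …`. -/
def signedDomain : Set ℂ := {z | ∀ m : ℕ, z ≠ -2 - 2 * (m : ℂ)}

/-- The transform of odd functions with the kernel `|t|^z sign t / Γ((z+1)/2)`, for
`z ≠ -2, -4, -6, …`. -/
def signedJ (n : ℕ) (z : ℂ) (f : UnitSphere n → ℂ) : UnitSphere n → ℂ :=
  sphereTransform n signedKernel signedDomain z f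

/-- `4 π^n / (Γ(-z/2) Γ((z+n+1)/2))`, which is `0` at the poles of the Gamma factors. -/
def evenConst (n : ℕ) (z : ℂ) : ℂ :=
  4 * (Real.pi : ℂ) ^ n / (Complex.Gamma (-z / 2) * Complex.Gamma ((z + n + 1) / 2))

/-- `4 π^n / (Γ((1-z)/2) Γ((z+n+2)/2))`, which is `0` at the poles of the Gamma factors. -/
def oddConst (n : ℕ) (z : ℂ) : ℂ :=
  4 * (Real.pi : ℂ) ^ n / (Complex.Gamma ((1 - z) / 2) * Complex.Gamma ((z + n + 2) / 2))

/-- `Γ((z+2)/2) / Γ((z+1)/2)`. -/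
def gammaRatio (z : ℂ) : ℂ := Complex.Gamma ((z + 2) / 2) / Complex.Gamma ((z + 1) / 2)

end

open Set Filter Topology
open scoped FourierTransform

/-! Both parities are treated at once through the kernel `K_z(t) = |t|^z (sign t)^e / Γ((z+1+e)/2)`
with `e = 0, 1` (`parityKernel`). A function `f` of parity `e` is spread out to a Schwartz function
`G(x) = b(|x|) |x|^p f(x/|x|)`, where `b` is a bump on the half line. The integral of `G(x)
K_z(⟨ξ,x⟩)` over `ℝ^(n+1)` is then computed in two ways.

In polar coordinates it is `J_z f(ξ)` times the radial moment of `b`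
(`integral_radialExtension_mul_parityKernel`). By the one-dimensional functional equation in the
direction `ξ`, it is an explicit factor times `∫_0^∞ 𝓕G(sξ) s^(-z-1) ds`
(`SchwartzMap.integral_mul_parityKernel`). The functional equation is obtained from the Fourier
transform of Gaussians by a Mellin transform in their width. The two computations agree for `-1 < Re
z < 0`, and the second one is holomorphic for `Re z < 0`, so it continues `J_z f` to the whole plane
(`isContinuation_transformExt`).

For inversion put `μ = -z-n-1`. On the left half plane `J_z f` is a multiple of the Mellin transform
of `𝓕G` along rays, at the exponent `μ+n+1`. That is exactly the exponent which polar coordinates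
attach to the integral of `𝓕G` against `K_μ`. If also `-1 < Re μ < 0`, a second use of the
functional equation and `𝓕𝓕G(x) = G(-x)` give back `f`; the product of the two factors is the
constant (`parityJ_parityJ_of_strip`). To leave the strip, the identity is paired with a test
function. Since `J_μ` is symmetric (`integral_parityJ_mul_eq`), it reads `⟨J_z f, J_μ g⟩ = c(z) ⟨f,
g⟩` with both sides entire in `z`; the choice of the conjugate of the error as `g` shows that the
error vanishes (`parityJ_parityJ`).

Smoothness comes from differentiation of the ray integral for `Re z < 0`, and for `Re z > -1` from a
reflection that moves the dependence on `ξ` from the singular kernel to `G`. The third statement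
follows from the second by the factor `gammaRatio`. -/

/-! ### Holomorphic parameter integrals and polar coordinates. -/

/-- An integral depending holomorphically on a parameter, under a locally uniform domination. -/
theorem differentiableOn_integral_of_locally_dominated {α : Type*} [MeasurableSpace α]
    {μ : Measure α} {U : Set ℂ} (hU : IsOpen U) {F : ℂ → α → ℂ}
    (hmeas : ∀ z ∈ U, AEStronglyMeasurable (F z) μ)
    (hdiff : ∀ᵐ a ∂μ, DifferentiableOn ℂ (fun z => F z a) U)
    (hbound : ∀ z ∈ U, ∃ B : α → ℝ, Integrable B μ ∧
      ∃ s ∈ 𝓝 z, ∀ᵐ a ∂μ, ∀ w ∈ s, ‖F w a‖ ≤ B a) :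
    DifferentiableOn ℂ (fun z => ∫ a, F z a ∂μ) U := by
  intro z hz
  obtain ⟨B, hB, s, hs, hBs⟩ := hbound z hz
  obtain ⟨r, hr, hrs⟩ := Metric.mem_nhds_iff.1 (inter_mem hs (hU.mem_nhds hz))
  have hball : ∀ w ∈ ball z (r / 2), closedBall w (r / 4) ⊆ ball z r := by
    intro w hw x hx
    rw [mem_ball] at *
    rw [mem_closedBall] at hx
    linarith [dist_triangle x w z]
  have hderiv : ∀ᵐ a ∂μ, ∀ w ∈ ball z (r / 2),
      HasDerivAt (fun z => F z a) (deriv (fun z => F z a) w) w := by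
    filter_upwards [hdiff] with a ha w hw
    have hw' : w ∈ ball z r := ball_subset_ball (by linarith) hw
    exact (ha.differentiableAt (hU.mem_nhds (hrs hw').2)).hasDerivAt
  -- Cauchy's estimate on circles of radius `r / 4`: a bound for the integrand also bounds its
  -- derivative.
  have hle : ∀ᵐ a ∂μ, ∀ w ∈ ball z (r / 2),
      ‖deriv (fun z => F z a) w‖ ≤ B a / (r / 4) := by
    filter_upwards [hdiff, hBs] with a ha hb w hw
    refine Complex.norm_deriv_le_of_forall_mem_sphere_norm_le (by linarith) ?_ ?_
    · refine DifferentiableOn.diffContOnCl ?_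
      rw [closure_ball w (by linarith)]
      exact ha.mono fun x hx => (hrs (hball w hw hx)).2
    · exact fun x hx => hb x (hrs (hball w hw (sphere_subset_closedBall hx))).1
  have hzr : z ∈ ball z (r / 2) := mem_ball_self (by linarith)
  classical
  -- The derivative is a limit of difference quotients. The filter keeps `z + h` inside `U`, where
  -- measurability is assumed.
  have hmeas' : AEStronglyMeasurable (fun a => deriv (fun z => F z a) z) μ := by
    refine @aestronglyMeasurable_of_tendsto_ae _ _ _ _ _ _ _ (𝓝[≠] (0 : ℂ) ⊓ 𝓟 (ball 0 r)) ?_ inferInstance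
      ( fun h a => if h ∈ ball (0 : ℂ) r then h⁻¹ * (F (z + h) a - F z a) else 0) _ ?_ ?_
    case refine_3 =>
      filter_upwards [hderiv] with a ha
      have := (hasDerivAt_iff_tendsto_slope_zero.1 (ha z hzr)).mono_left
        (inf_le_left : 𝓝[≠] (0 : ℂ) ⊓ 𝓟 (ball 0 r) ≤ _)
      refine this.congr' ?_
      filter_upwards [mem_inf_of_right (mem_principal_self _)] with h hh
      simp only [hh, if_true, smul_eq_mul]
    case refine_1 =>
      rw [inf_principal_neBot_iff]
      intro t ht
      exact NeBot.nonempty_of_mem inferInstance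
        (inter_mem ht (mem_nhdsWithin_of_mem_nhds (ball_mem_nhds 0 hr)))
    case refine_2 =>
      intro h
      split_ifs with hh
      · refine AEStronglyMeasurable.const_mul ((hmeas _ ?_).sub (hmeas z hz)) _
        refine (hrs ?_).2
        simpa [mem_ball, dist_eq_norm] using hh
      · exact aestronglyMeasurable_const
  refine (hasDerivAt_integral_of_dominated_loc_of_deriv_le (ball_mem_nhds z (by linarith : 0 < r/2))
    ?_ ?_ hmeas' hle (hB.div_const _) hderiv).2.differentiableAt.differentiableWithinAt
  · filter_upwards [hU.mem_nhds hz] with w hw using hmeas w hw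
  · refine hB.mono' (hmeas z hz) ?_
    filter_upwards [hBs] with a ha using ha z (mem_of_mem_nhds hs)

/-- The polar coordinate formula on `ℝ^(n+1)`. -/
theorem integral_eq_integral_sphere_prod (n : ℕ) (g : EuclideanSpace ℝ (Fin (n + 1)) → ℂ) :
    ∫ x, g x = ∫ p, g ((p.2 : ℝ) • (p.1 : EuclideanSpace ℝ (Fin (n + 1))))
      ∂((surfaceMeasure n).prod (Measure.volumeIoiPow n)) := by
  have h := (volume : Measure (EuclideanSpace ℝ (Fin (n + 1)))).measurePreserving_homeomorphUnitSphereProd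
  have h2 := h.integral_comp (Homeomorph.measurableEmbedding _)
    (fun p => g ((p.2 : ℝ) • (p.1 : EuclideanSpace ℝ (Fin (n + 1)))))
  simp only [finrank_euclideanSpace, Fintype.card_fin, Nat.add_sub_cancel] at h2
  have e : ∫ x, g x = ∫ x in {0}ᶜ, g x := by rw [restrict_compl_singleton]
  rw [surfaceMeasure, ← h2, e]
  refine (integral_subtype_comap (measurableSet_singleton (0 : EuclideanSpace ℝ (Fin (n + 1)))).compl g).symm.trans ?_
  refine integral_congr_ae (Eventually.of_forall fun x => ?_)
  have : (x : EuclideanSpace ℝ (Fin (n + 1))) ≠ 0 := x.2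
  simp [smul_smul, this]

theorem integrable_iff_integrable_sphere_prod (n : ℕ) {F : Type*} [NormedAddCommGroup F]
    (g : EuclideanSpace ℝ (Fin (n + 1)) → F) :
    Integrable g ↔ Integrable (fun p : UnitSphere n × Ioi (0 : ℝ) =>
      g ((p.2 : ℝ) • (p.1 : EuclideanSpace ℝ (Fin (n + 1)))))
      ((surfaceMeasure n).prod (Measure.volumeIoiPow n)) := by
  have h := (volume : Measure (EuclideanSpace ℝ (Fin (n + 1)))).measurePreserving_homeomorphUnitSphereProd
  have h2 := h.integrable_comp_emb (Homeomorph.measurableEmbedding _)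
    (g := fun p => g ((p.2 : ℝ) • (p.1 : EuclideanSpace ℝ (Fin (n + 1)))))
  simp only [finrank_euclideanSpace, Fintype.card_fin, Nat.add_sub_cancel] at h2
  have e : Integrable g ↔ IntegrableOn g {0}ᶜ := by
    rw [IntegrableOn, restrict_compl_singleton]
  rw [surfaceMeasure, ← h2, e]
  refine (integrableOn_iff_comap_subtypeVal (f := g) (measurableSet_singleton (0 : EuclideanSpace ℝ (Fin (n + 1)))).compl).trans ?_
  refine integrable_congr (Eventually.of_forall fun x => ?_)
  have : (x : EuclideanSpace ℝ (Fin (n + 1))) ≠ 0 := x.2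
  simp [smul_smul, this]

theorem integral_volumeIoiPow (n : ℕ) (g : ℝ → ℂ) :
    ∫ r : Ioi (0 : ℝ), g r ∂(Measure.volumeIoiPow n) = ∫ r in Ioi (0 : ℝ), (r : ℂ) ^ n * g r := by
  simp only [Measure.volumeIoiPow, ENNReal.ofReal]
  rw [integral_withDensity_eq_integral_smul,
    integral_subtype_comap measurableSet_Ioi fun a : ℝ ↦ Real.toNNReal (a ^ n) • g a,
    setIntegral_congr_fun measurableSet_Ioi fun x hx ↦ ?_]
  · rw [NNReal.smul_def, Real.coe_toNNReal _ (pow_nonneg hx.out.le _)]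
    simp
  · exact (measurable_subtype_coe.pow_const _).real_toNNReal

/-- The cone over the great subsphere orthogonal to `ξ` lies in a proper linear subspace, which is
Lebesgue null. -/
theorem surfaceMeasure_inner_eq_zero (n : ℕ) (ξ : UnitSphere n) :
    ∀ᵐ η : UnitSphere n ∂(surfaceMeasure n),
      ⟪(ξ : EuclideanSpace ℝ (Fin (n + 1))), (η : EuclideanSpace ℝ (Fin (n + 1)))⟫_ℝ ≠ 0 := by
  rw [ae_iff]
  simp only [ne_eq, not_not]
  refine (Measure.toSphere_apply' (volume : Measure (EuclideanSpace ℝ (Fin (n + 1))))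
    (measurableSet_eq_fun (by fun_prop) (by fun_prop))).trans ?_
  refine mul_eq_zero.2 (Or.inr ?_)
  have hξ : (ξ : EuclideanSpace ℝ (Fin (n + 1))) ≠ 0 := ne_zero_of_mem_unit_sphere ξ
  refine measure_mono_null (μ := (volume : Measure (EuclideanSpace ℝ (Fin (n + 1))))) ?_
    (Measure.addHaar_submodule _ (LinearMap.ker (innerSL ℝ (ξ : EuclideanSpace ℝ (Fin (n + 1)))).toLinearMap) ?_)
  · rintro _ ⟨r, -, _, ⟨η, hη, rfl⟩, rfl⟩
    simp only [mem_ofPred_eq] at hη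
    simp [hη]
  · intro h
    have : (ξ : EuclideanSpace ℝ (Fin (n + 1))) ∈ LinearMap.ker (innerSL ℝ (ξ : EuclideanSpace ℝ (Fin (n + 1)))).toLinearMap := h ▸ trivial
    simp at this

/-! ### The homogeneous kernels. -/

/-- The kernel `|t|^z (sign t)^e`. -/
noncomputable def rawKernel (e : ℕ) (z : ℂ) (t : ℝ) : ℂ :=
  ((|t| : ℝ) : ℂ) ^ z * ((Real.sign t : ℝ) : ℂ) ^ e

/-- The kernel `|t|^z (sign t)^e / Γ((z+1+e)/2)`. -/
noncomputable def parityKernel (e : ℕ) (z : ℂ) (t : ℝ) : ℂ :=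
  rawKernel e z t / Complex.Gamma ((z + 1 + e) / 2)

theorem evenKernel_eq_parityKernel : evenKernel = parityKernel 0 := by
  ext z t; simp [evenKernel, parityKernel, rawKernel]

theorem oddKernel_eq_parityKernel : oddKernel = parityKernel 1 := by
  ext z t
  simp only [oddKernel, parityKernel, rawKernel, pow_one, Nat.cast_one]
  ring_nf

theorem norm_rawKernel_le (e : ℕ) (z : ℂ) {t : ℝ} (ht : t ≠ 0) :
    ‖rawKernel e z t‖ ≤ |t| ^ z.re := by
  rw [rawKernel, norm_mul, Complex.norm_cpow_eq_rpow_re_of_pos (abs_pos.2 ht), norm_pow,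
    Complex.norm_real]
  refine mul_le_of_le_one_right (by positivity) (pow_le_one₀ (norm_nonneg _) ?_)
  rcases Real.sign_apply_eq t with h | h | h <;> simp [h]

theorem measurable_rawKernel (e : ℕ) (z : ℂ) : Measurable (rawKernel e z) := by
  have h : Measurable Real.sign := by
    unfold Real.sign
    exact Measurable.ite measurableSet_Iio measurable_const
      (Measurable.ite measurableSet_Ioi measurable_const measurable_const)
  unfold rawKernel
  fun_prop

theorem measurable_parityKernel (e : ℕ) (z : ℂ) : Measurable (parityKernel e z) :=
  (measurable_rawKernel e z).div_const _

theorem rawKernel_mul (e : ℕ) (z : ℂ) {r : ℝ} (hr : 0 < r) (t : ℝ) :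
    rawKernel e z (r * t) = (r : ℂ) ^ z * rawKernel e z t := by
  have h : Real.sign (r * t) = Real.sign t := by
    rcases lt_trichotomy t 0 with h | h | h
    · rw [Real.sign_of_neg h, Real.sign_of_neg (mul_neg_of_pos_of_neg hr h)]
    · simp [h]
    · rw [Real.sign_of_pos h, Real.sign_of_pos (mul_pos hr h)]
  rw [rawKernel, rawKernel, h, abs_mul, abs_of_pos hr, Complex.ofReal_mul,
    Complex.mul_cpow_ofReal_nonneg hr.le (abs_nonneg t), mul_assoc]

theorem rawKernel_neg (e : ℕ) (z : ℂ) (t : ℝ) : rawKernel e z (-t) = (-1) ^ e * rawKernel e z t := by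
  rw [rawKernel, rawKernel, abs_neg, Real.sign_neg, Complex.ofReal_neg, neg_pow]
  ring

theorem parityKernel_neg (e : ℕ) (z : ℂ) (t : ℝ) :
    parityKernel e z (-t) = (-1) ^ e * parityKernel e z t := by
  rw [parityKernel, rawKernel_neg, parityKernel, mul_div_assoc]

theorem differentiable_rawKernel (e : ℕ) {t : ℝ} (ht : t ≠ 0) :
    Differentiable ℂ (fun z => rawKernel e z t) := by
  have : ((|t| : ℝ) : ℂ) ≠ 0 := by simpa using ht
  unfold rawKernel
  exact fun z => (DifferentiableAt.const_cpow differentiableAt_id (Or.inl this)).mul_const _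

/-! ### Integrability of powers of a linear form. -/

theorem integrable_abs_rpow_mul_inv_one_add_sq {a : ℝ} (ha : -1 < a) (ha' : a < 1) :
    Integrable (fun t : ℝ => |t| ^ a * (1 + t ^ 2)⁻¹) := by
  have h1 : IntegrableOn (fun t : ℝ => |t| ^ a * (1 + t ^ 2)⁻¹) (Ioi 0) := by
    rw [← Ioc_union_Ioi_eq_Ioi zero_le_one]
    refine IntegrableOn.union ?_ ?_
    · have : IntegrableOn (fun t : ℝ => t ^ a) (Ioc 0 1) :=
        (intervalIntegral.intervalIntegrable_rpow' ha).1
      refine this.mono' (by fun_prop) ?_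
      filter_upwards [ae_restrict_mem measurableSet_Ioc] with t ht
      rw [abs_of_pos ht.1, norm_mul, Real.norm_of_nonneg (Real.rpow_nonneg ht.1.le _),
        Real.norm_of_nonneg (by positivity)]
      exact mul_le_of_le_one_right (Real.rpow_nonneg ht.1.le _)
        (inv_le_one_of_one_le₀ (by nlinarith [sq_nonneg t]))
    · have : IntegrableOn (fun t : ℝ => t ^ (a - 2)) (Ioi 1) :=
        integrableOn_Ioi_rpow_of_lt (by linarith) one_pos
      refine this.mono' (by fun_prop) ?_
      filter_upwards [ae_restrict_mem measurableSet_Ioi] with t ht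
      have ht0 : 0 < t := one_pos.trans ht
      rw [abs_of_pos ht0, norm_mul, Real.norm_of_nonneg (Real.rpow_nonneg ht0.le _),
        Real.norm_of_nonneg (by positivity), Real.rpow_sub ht0, div_eq_mul_inv]
      gcongr
      norm_cast
      simp
  rw [← integrableOn_univ, ← Iic_union_Ioi (a := (0 : ℝ))]
  refine IntegrableOn.union ?_ h1
  rw [integrableOn_Iic_iff_integrableOn_Iio]
  have h2 := ((Measure.measurePreserving_neg (volume : Measure ℝ)).integrableOn_comp_preimage
    (MeasurableEquiv.neg ℝ).measurableEmbedding).2 h1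
  simpa [Function.comp_def] using h2

/-- Integrability of `|x 0|^a` against a product weight on `ℝ^(n+1)`. -/
theorem integrable_abs_coord_rpow_mul_prod (n : ℕ) {a : ℝ} (ha : -1 < a) (ha' : a < 1) :
    Integrable (fun x : EuclideanSpace ℝ (Fin (n + 1)) => |x 0| ^ a * ∏ i, (1 + x i ^ 2)⁻¹) := by
  have h : Integrable (fun x : Fin (n + 1) → ℝ =>
      ∏ i, ((if i = 0 then |x i| ^ a else 1) * (1 + x i ^ 2)⁻¹)) := by
    refine Integrable.fintype_prod (f := fun i t => (if i = 0 then |t| ^ a else 1) * (1 + t ^ 2)⁻¹)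
      fun i => ?_
    by_cases hi : i = 0
    · simpa [hi] using integrable_abs_rpow_mul_inv_one_add_sq ha ha'
    · simpa [hi] using integrable_inv_one_add_sq
  have h2 := ((EuclideanSpace.volume_preserving_symm_measurableEquiv_toLp
    (Fin (n + 1))).integrable_comp_emb (MeasurableEquiv.measurableEmbedding _)).2 h
  refine h2.congr (Eventually.of_forall fun x => ?_)
  simp only [Function.comp_apply, Finset.prod_mul_distrib, Finset.prod_ite_eq', Finset.mem_univ,
    if_true]
  rfl

/-- The reflection in the hyperplane orthogonal to `v - ξ` exchanges the unit vectors `v` and `ξ`.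
-/
theorem exists_linearIsometryEquiv_inner_eq (n : ℕ) {ξ : EuclideanSpace ℝ (Fin (n + 1))}
    (hξ : ‖ξ‖ = 1) : ∃ L : EuclideanSpace ℝ (Fin (n + 1)) ≃ₗᵢ[ℝ] EuclideanSpace ℝ (Fin (n + 1)),
      ∀ x, ⟪ξ, L x⟫_ℝ = x 0 := by
  set v : EuclideanSpace ℝ (Fin (n + 1)) := EuclideanSpace.single 0 1
  have hv : ‖v‖ = ‖ξ‖ := by simp [v, hξ]
  refine ⟨(ℝ ∙ (v - ξ))ᗮ.reflection, fun x => ?_⟩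
  have h : ((ℝ ∙ (v - ξ))ᗮ).reflection v = ξ := Submodule.reflection_sub hv
  refine (congrArg (fun y => ⟪y, (ℝ ∙ (v - ξ))ᗮ.reflection x⟫_ℝ) h.symm).trans ?_
  simp only
  rw [LinearIsometryEquiv.inner_map_map]
  simp [v, EuclideanSpace.inner_single_left]

/-- A rotation makes `ξ` the first basis vector; then the radial weight is at most the product of
the weights `(1 + x_i^2)⁻¹`, and the problem splits into one-dimensional ones. The same rotation
makes the value independent of `ξ`, which yields bounds uniform in `ξ`. -/
theorem integrable_abs_inner_rpow_mul_weight (n : ℕ) {a : ℝ} (ha : -1 < a) (ha' : a < 1)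
    {ξ : EuclideanSpace ℝ (Fin (n + 1))} (hξ : ‖ξ‖ = 1) :
    Integrable (fun x : EuclideanSpace ℝ (Fin (n + 1)) =>
      |⟪ξ, x⟫_ℝ| ^ a * ((1 + ‖x‖ ^ 2) ^ (n + 1))⁻¹) ∧
    ∫ x : EuclideanSpace ℝ (Fin (n + 1)), |⟪ξ, x⟫_ℝ| ^ a * ((1 + ‖x‖ ^ 2) ^ (n + 1))⁻¹ =
      ∫ x : EuclideanSpace ℝ (Fin (n + 1)), |x 0| ^ a * ((1 + ‖x‖ ^ 2) ^ (n + 1))⁻¹ := by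
  obtain ⟨L, hL⟩ := exists_linearIsometryEquiv_inner_eq n hξ
  have h0 : Integrable (fun x : EuclideanSpace ℝ (Fin (n + 1)) =>
      |x 0| ^ a * ((1 + ‖x‖ ^ 2) ^ (n + 1))⁻¹) := by
    refine (integrable_abs_coord_rpow_mul_prod n ha ha').mono'
      (by fun_prop) (Eventually.of_forall fun x => ?_)
    rw [Real.norm_of_nonneg (by positivity)]
    refine mul_le_mul_of_nonneg_left ?_ (by positivity)
    rw [Finset.prod_inv_distrib]
    refine inv_anti₀ (Finset.prod_pos fun i _ => by positivity) ?_
    calc ∏ i, (1 + x i ^ 2) ≤ ∏ i : Fin (n + 1), (1 + ‖x‖ ^ 2) := by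
          refine Finset.prod_le_prod (fun i _ => by positivity) fun i _ => ?_
          have := PiLp.norm_apply_le x i
          rw [Real.norm_eq_abs] at this
          have := sq_le_sq' (by linarith [abs_nonneg (x i), norm_nonneg x]) this
          rw [sq_abs] at this
          linarith
      _ = _ := by simp
  refine ⟨?_, ?_⟩
  · rw [← L.measurePreserving.integrable_comp_emb L.toHomeomorph.measurableEmbedding]
    simpa [Function.comp_def, hL] using h0
  · rw [← L.measurePreserving.integral_comp L.toHomeomorph.measurableEmbedding]
    simp [hL]

theorem volumeIoiPow_ne_zero (n : ℕ) : Measure.volumeIoiPow n ≠ 0 := by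
  intro h
  have h1 := Measure.volumeIoiPow_apply_Iio n ⟨1, mem_Ioi.2 one_pos⟩
  rw [h] at h1
  simp only [Measure.coe_zero, Pi.zero_apply, one_pow] at h1
  have : (0 : ℝ) < 1 / ((n : ℝ) + 1) := by positivity
  exact (ENNReal.ofReal_pos.2 this).ne h1

instance (n : ℕ) : IsFiniteMeasure (surfaceMeasure n) := by
  unfold surfaceMeasure; infer_instance

instance (n : ℕ) : (surfaceMeasure n).IsOpenPosMeasure := by
  unfold surfaceMeasure; infer_instance

/-- In polar coordinates the weighted integral over `ℝ^(n+1)` is the integral over the sphere times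
a positive radial constant. As the former does not depend on `ξ`, neither does the latter. -/
theorem exists_bound_integral_abs_inner_rpow (n : ℕ) {a : ℝ} (ha : -1 < a) :
    ∃ C : ℝ, ∀ ξ : UnitSphere n,
      Integrable (fun η : UnitSphere n => |⟪(ξ : EuclideanSpace ℝ (Fin (n + 1))),
        (η : EuclideanSpace ℝ (Fin (n + 1)))⟫_ℝ| ^ a) (surfaceMeasure n) ∧
      ∫ η : UnitSphere n, |⟪(ξ : EuclideanSpace ℝ (Fin (n + 1))),
        (η : EuclideanSpace ℝ (Fin (n + 1)))⟫_ℝ| ^ a ∂(surfaceMeasure n) ≤ C := by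
  -- On the sphere `|⟪ξ, η⟫| ≤ 1`, so larger exponents are dominated by the exponent `0`.
  wlog ha' : a < 1 generalizing a
  · obtain ⟨C, hC⟩ := this (a := 0) (by norm_num) one_pos
    refine ⟨C, fun ξ => ?_⟩
    have hle : ∀ η : UnitSphere n, |⟪(ξ : EuclideanSpace ℝ (Fin (n + 1))),
        (η : EuclideanSpace ℝ (Fin (n + 1)))⟫_ℝ| ^ a ≤ |⟪(ξ : EuclideanSpace ℝ (Fin (n + 1))),
        (η : EuclideanSpace ℝ (Fin (n + 1)))⟫_ℝ| ^ (0 : ℝ) := by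
      intro η
      rw [Real.rpow_zero]
      refine Real.rpow_le_one (abs_nonneg _) ?_ (by linarith)
      simpa using abs_real_inner_le_norm (ξ : EuclideanSpace ℝ (Fin (n + 1))) η
    have hi : Integrable (fun η : UnitSphere n => |⟪(ξ : EuclideanSpace ℝ (Fin (n + 1))),
        (η : EuclideanSpace ℝ (Fin (n + 1)))⟫_ℝ| ^ a) (surfaceMeasure n) := by
      refine (hC ξ).1.mono' ?_ (Eventually.of_forall fun η => ?_)
      · exact Measurable.aestronglyMeasurable (by fun_prop)
      · rw [Real.norm_of_nonneg (by positivity)]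
        exact hle η
    exact ⟨hi, (integral_mono hi (hC ξ).1 hle).trans (hC ξ).2⟩
  set v : ℝ → ℝ := fun r => r ^ a * ((1 + r ^ 2) ^ (n + 1))⁻¹
  set T := ∫ x : EuclideanSpace ℝ (Fin (n + 1)), |x 0| ^ a * ((1 + ‖x‖ ^ 2) ^ (n + 1))⁻¹
  have hpolar : ∀ ξ : UnitSphere n, ∀ p : UnitSphere n × Ioi (0 : ℝ),
      |⟪(ξ : EuclideanSpace ℝ (Fin (n + 1))), (p.2 : ℝ) • (p.1 : EuclideanSpace ℝ (Fin (n + 1)))⟫_ℝ| ^ a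
        * ((1 + ‖(p.2 : ℝ) • (p.1 : EuclideanSpace ℝ (Fin (n + 1)))‖ ^ 2) ^ (n + 1))⁻¹ =
      |⟪(ξ : EuclideanSpace ℝ (Fin (n + 1))), (p.1 : EuclideanSpace ℝ (Fin (n + 1)))⟫_ℝ| ^ a *
        v p.2 := by
    intro ξ p
    have hp : 0 < (p.2 : ℝ) := p.2.2
    rw [inner_smul_right, abs_mul, Real.mul_rpow (abs_nonneg _) (abs_nonneg _), norm_smul,
      Real.norm_eq_abs, abs_of_pos hp, norm_eq_of_mem_sphere, mul_one]
    simp only [v]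
    ring
  have hint : ∀ ξ : UnitSphere n, Integrable (fun p : UnitSphere n × Ioi (0 : ℝ) =>
      |⟪(ξ : EuclideanSpace ℝ (Fin (n + 1))), (p.1 : EuclideanSpace ℝ (Fin (n + 1)))⟫_ℝ| ^ a *
        v p.2) ((surfaceMeasure n).prod (Measure.volumeIoiPow n)) := by
    intro ξ
    have h := (integrable_abs_inner_rpow_mul_weight n ha ha' (norm_eq_of_mem_sphere ξ)).1
    rw [integrable_iff_integrable_sphere_prod] at h
    exact h.congr (Eventually.of_forall fun p => hpolar ξ p)
  have hv0 : ∀ r : Ioi (0 : ℝ), 0 < v r := fun r => by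
    have : 0 < (r : ℝ) := r.2
    positivity
  have hS : ∀ ξ : UnitSphere n, Integrable (fun η : UnitSphere n =>
      |⟪(ξ : EuclideanSpace ℝ (Fin (n + 1))), (η : EuclideanSpace ℝ (Fin (n + 1)))⟫_ℝ| ^ a)
      (surfaceMeasure n) := by
    intro ξ
    have : (ae (Measure.volumeIoiPow n)).NeBot := ae_neBot.2 (volumeIoiPow_ne_zero n)
    obtain ⟨r, hr⟩ := (hint ξ).prod_left_ae.exists
    exact (integrable_mul_const_iff (isUnit_iff_ne_zero.2 (hv0 r).ne') _).1 hr
  have hmul : ∀ ξ : UnitSphere n, (∫ η : UnitSphere n, |⟪(ξ : EuclideanSpace ℝ (Fin (n + 1))),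
        (η : EuclideanSpace ℝ (Fin (n + 1)))⟫_ℝ| ^ a ∂(surfaceMeasure n)) *
        ∫ r : Ioi (0 : ℝ), v r ∂(Measure.volumeIoiPow n) = T := by
    intro ξ
    have h := (integrable_abs_inner_rpow_mul_weight n ha ha' (norm_eq_of_mem_sphere ξ)).2
    refine Eq.trans ?_ h
    have h2 := integral_eq_integral_sphere_prod n (fun x => ((|⟪(ξ : EuclideanSpace ℝ (Fin (n + 1))), x⟫_ℝ| ^ a * ((1 + ‖x‖ ^ 2) ^ (n + 1))⁻¹ : ℝ) : ℂ))
    rw [integral_complex_ofReal, integral_complex_ofReal, Complex.ofReal_inj] at h2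
    rw [h2]
    simp_rw [hpolar ξ]
    exact (integral_prod_mul (fun η : UnitSphere n => |⟪(ξ : EuclideanSpace ℝ (Fin (n + 1))), (η : EuclideanSpace ℝ (Fin (n + 1)))⟫_ℝ| ^ a) (fun r : Ioi (0 : ℝ) => v r)).symm
  by_cases hne : Nonempty (UnitSphere n)
  · obtain ⟨ξ₀⟩ := hne
    refine ⟨T / ∫ r : Ioi (0 : ℝ), v r ∂(Measure.volumeIoiPow n), fun ξ => ⟨hS ξ, ?_⟩⟩
    have hσ : surfaceMeasure n ≠ 0 := by
      intro h
      have := isOpen_univ.measure_ne_zero (surfaceMeasure n) ⟨ξ₀, mem_univ _⟩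
      simp [h] at this
    have : (ae (surfaceMeasure n)).NeBot := ae_neBot.2 hσ
    -- A slice of the product integrand at a point with nonzero inner product shows that the radial
    -- factor is integrable.
    obtain ⟨η, hη, hη0⟩ := ((hint ξ).prod_right_ae.and (surfaceMeasure_inner_eq_zero n ξ)).exists
    have hvi : Integrable (fun r : Ioi (0 : ℝ) => v r) (Measure.volumeIoiPow n) :=
      (integrable_const_mul_iff (isUnit_iff_ne_zero.2
        (Real.rpow_pos_of_pos (abs_pos.2 hη0) a).ne') _).1 hη
    have hpos : 0 < ∫ r : Ioi (0 : ℝ), v r ∂(Measure.volumeIoiPow n) := by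
      rw [integral_pos_iff_support_of_nonneg (fun r => (hv0 r).le) hvi]
      have : Function.support (fun r : Ioi (0 : ℝ) => v r) = univ :=
        eq_univ_of_forall fun r => (hv0 r).ne'
      rw [this]
      exact Measure.measure_univ_pos.2 (volumeIoiPow_ne_zero n)
    rw [le_div_iff₀ hpos]
    exact (hmul ξ).le
  · exact ⟨0, fun ξ => (hne ⟨ξ⟩).elim⟩

theorem ae_inner_ne_zero {n : ℕ} {ξ : EuclideanSpace ℝ (Fin (n + 1))} (hξ : ‖ξ‖ = 1) :
    ∀ᵐ x : EuclideanSpace ℝ (Fin (n + 1)), ⟪ξ, x⟫_ℝ ≠ 0 := by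
  rw [ae_iff]
  refine measure_mono_null (t := (LinearMap.ker (innerSL ℝ ξ).toLinearMap : Set _)) ?_
    (Measure.addHaar_submodule _ _ ?_)
  · intro x hx
    simpa using hx
  · intro h
    have : ξ ∈ LinearMap.ker (innerSL ℝ ξ).toLinearMap := h ▸ trivial
    simp only [LinearMap.mem_ker, ContinuousLinearMap.coe_coe, innerSL_apply_apply,
      real_inner_self_eq_norm_sq, hξ] at this
    norm_num at this

theorem locallyIntegrable_rawKernel_inner (n e : ℕ) {z : ℂ} (hz : -1 < z.re)
    {ξ : EuclideanSpace ℝ (Fin (n + 1))} (hξ : ‖ξ‖ = 1) :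
    LocallyIntegrable (fun x : EuclideanSpace ℝ (Fin (n + 1)) => rawKernel e z ⟪ξ, x⟫_ℝ) := by
  rw [locallyIntegrable_iff]
  intro K hK
  obtain ⟨R, hR⟩ := hK.isBounded.exists_norm_le
  -- The weighted bound needs an exponent in `(-1, 1)`; the excess `Re z - a ≥ 0` only costs a
  -- bounded factor on a compact set.
  set a := min z.re 0
  have ha : -1 < a := lt_min hz (by norm_num)
  have ha' : a < 1 := (min_le_right _ _).trans_lt one_pos
  have hI := (integrable_abs_inner_rpow_mul_weight n ha ha' hξ).1
  have hmeas : AEStronglyMeasurable (fun x : EuclideanSpace ℝ (Fin (n + 1)) =>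
      rawKernel e z ⟪ξ, x⟫_ℝ) :=
    ((measurable_rawKernel e z).comp (by fun_prop)).aestronglyMeasurable
  have hne := ae_inner_ne_zero hξ
  refine ((hI.const_mul ((1 + R) ^ (z.re - a) * (1 + R ^ 2) ^ (n + 1))).integrableOn (s := K)).mono'
    hmeas.restrict ?_
  filter_upwards [ae_restrict_mem hK.measurableSet, ae_restrict_of_ae hne] with x hx hx0
  refine (norm_rawKernel_le e z hx0).trans ?_
  have hxR := hR x hx
  have hpos : 0 < |⟪ξ, x⟫_ℝ| := abs_pos.2 hx0
  have hle : |⟪ξ, x⟫_ℝ| ≤ 1 + R := by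
    have := abs_real_inner_le_norm ξ x
    rw [hξ, one_mul] at this
    linarith
  have h1 : |⟪ξ, x⟫_ℝ| ^ z.re ≤ (1 + R) ^ (z.re - a) * |⟪ξ, x⟫_ℝ| ^ a := by
    calc |⟪ξ, x⟫_ℝ| ^ z.re = |⟪ξ, x⟫_ℝ| ^ (z.re - a) * |⟪ξ, x⟫_ℝ| ^ a := by
          rw [← Real.rpow_add hpos]; simp
      _ ≤ _ := by
          gcongr
          exact sub_nonneg.2 (min_le_left _ _)
  have hR0 : 0 ≤ R := (norm_nonneg x).trans hxR
  have h2 : 1 ≤ (1 + R ^ 2) ^ (n + 1) * ((1 + ‖x‖ ^ 2) ^ (n + 1))⁻¹ := by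
    rw [← div_eq_mul_inv, one_le_div (by positivity)]
    gcongr
  calc |⟪ξ, x⟫_ℝ| ^ z.re ≤ (1 + R) ^ (z.re - a) * |⟪ξ, x⟫_ℝ| ^ a * 1 := by simpa using h1
    _ ≤ (1 + R) ^ (z.re - a) * |⟪ξ, x⟫_ℝ| ^ a *
        ((1 + R ^ 2) ^ (n + 1) * ((1 + ‖x‖ ^ 2) ^ (n + 1))⁻¹) := by gcongr
    _ = _ := by ring

theorem SchwartzMap.exists_norm_le_inv_one_add_sq_pow {E F : Type*} [NormedAddCommGroup E]
    [NormedSpace ℝ E] [NormedAddCommGroup F] [NormedSpace ℝ F] (G : SchwartzMap E F) (k : ℕ) :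
    ∃ C, 0 ≤ C ∧ ∀ x, ‖G x‖ ≤ C * ((1 + ‖x‖ ^ 2) ^ k)⁻¹ := by
  refine ⟨2 ^ (2 * k) * ((Finset.Iic (2 * k, 0)).sup fun m => SchwartzMap.seminorm ℝ m.1 m.2) G,
    by positivity, fun x => ?_⟩
  have h := SchwartzMap.one_add_le_sup_seminorm_apply (𝕜 := ℝ) (m := (2 * k, 0)) le_rfl le_rfl G x
  rw [norm_iteratedFDeriv_zero] at h
  rw [← div_eq_mul_inv, le_div_iff₀ (by positivity), mul_comm]
  refine le_trans ?_ h
  gcongr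
  rw [pow_mul]
  gcongr
  nlinarith [norm_nonneg x]

/-- Integrability of a Schwartz function against a power of a linear form. -/
theorem SchwartzMap.integrable_mul_abs_inner_rpow {n : ℕ}
    (G : SchwartzMap (EuclideanSpace ℝ (Fin (n + 1))) ℂ) {a : ℝ} (ha : -1 < a) (ha' : a < 1)
    {ξ : EuclideanSpace ℝ (Fin (n + 1))} (hξ : ‖ξ‖ = 1) :
    Integrable (fun x => ‖G x‖ * |⟪ξ, x⟫_ℝ| ^ a) := by
  obtain ⟨C, hC0, hC⟩ := G.exists_norm_le_inv_one_add_sq_pow (n + 1)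
  refine ((integrable_abs_inner_rpow_mul_weight n ha ha' hξ).1.const_mul C).mono'
    (G.continuous.norm.measurable.mul (by fun_prop)).aestronglyMeasurable
    (Eventually.of_forall fun x => ?_)
  rw [Real.norm_of_nonneg (by positivity)]
  calc ‖G x‖ * |⟪ξ, x⟫_ℝ| ^ a ≤ C * ((1 + ‖x‖ ^ 2) ^ (n + 1))⁻¹ * |⟪ξ, x⟫_ℝ| ^ a := by
        gcongr
        exact hC x
    _ = _ := by ring

/-! ### Gaussians, Mellin transforms and the functional equation. -/

/-- The Mellin transform of an average of Gaussians. -/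
theorem mellin_integral_mul_exp_neg_sq {X : Type*} [MeasurableSpace X] {μ : Measure X} [SFinite μ]
    {g : X → ℂ} {τ : X → ℝ} (hg : AEStronglyMeasurable g μ) (hτ : Measurable τ)
    (hτ0 : ∀ᵐ x ∂μ, τ x ≠ 0) {p : ℂ} (hp : 0 < p.re)
    (hint : Integrable (fun x => ‖g x‖ * |τ x| ^ (-2 * p.re)) μ) :
    mellin (fun a : ℝ => ∫ x, g x * ((Real.exp (-(Real.pi * τ x ^ 2 * a)) : ℝ) : ℂ) ∂μ) p =
      Complex.Gamma p * (Real.pi : ℂ) ^ (-p) * ∫ x, g x * ((|τ x| : ℝ) : ℂ) ^ (-2 * p) ∂μ := by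
  set h : ℝ → X → ℂ := fun a x => (a : ℂ) ^ (p - 1) *
    (g x * ((Real.exp (-(Real.pi * τ x ^ 2 * a)) : ℝ) : ℂ)) with hh
  have hpos : ∀ x, τ x ≠ 0 → 0 < Real.pi * τ x ^ 2 := fun x hx =>
    mul_pos Real.pi_pos (sq_pos_of_ne_zero hx)
  have hnorm : ∀ x, ∀ a ∈ Ioi (0 : ℝ), ‖h a x‖ =
      ‖g x‖ * (a ^ (p.re - 1) * Real.exp (-(Real.pi * τ x ^ 2 * a))) := by
    intro x a ha
    rw [hh]
    simp only [norm_mul, Complex.norm_real, Real.norm_eq_abs, Real.abs_exp]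
    rw [Complex.norm_cpow_eq_rpow_re_of_pos ha]
    simp
    ring
  have hI : Integrable (Function.uncurry h) ((volume.restrict (Ioi 0)).prod μ) := by
    rw [integrable_prod_iff']
    · refine ⟨?_, ?_⟩
      · filter_upwards [hτ0] with x hx
        have h1 := integrableOn_rpow_mul_exp_neg_mul_rpow (p := 1) (s := p.re - 1) (by linarith)
          one_pos (hpos x hx)
        refine (h1.const_mul ‖g x‖).mono' ?_ ?_
        · simp only [Function.uncurry_apply_pair, hh]
          refine AEStronglyMeasurable.mul ?_ (AEStronglyMeasurable.const_mul ?_ _)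
          · exact Measurable.aestronglyMeasurable (by fun_prop)
          · exact Measurable.aestronglyMeasurable (by fun_prop)
        · filter_upwards [ae_restrict_mem measurableSet_Ioi] with a ha
          simp only [Function.uncurry_apply_pair, hnorm x a ha, Real.rpow_one, neg_mul, le_refl]
      -- The norm, integrated over `a`, is again a Gamma integral; `hint` is exactly the remaining
      -- condition for Fubini.
      · refine (hint.const_mul (Real.pi ^ (-p.re) * Real.Gamma p.re)).congr ?_
        filter_upwards [hτ0] with x hx
        simp only [Function.uncurry_apply_pair]
        rw [setIntegral_congr_fun measurableSet_Ioi (hnorm x), integral_const_mul,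
          Real.integral_rpow_mul_exp_neg_mul_Ioi hp (hpos x hx), one_div,
          Real.inv_rpow (hpos x hx).le, ← Real.rpow_neg (hpos x hx).le,
          Real.mul_rpow Real.pi_pos.le (sq_nonneg _), ← sq_abs (τ x), ← Real.rpow_natCast,
          ← Real.rpow_mul (abs_nonneg _)]
        push_cast
        ring_nf
    · refine AEStronglyMeasurable.mul ?_ (AEStronglyMeasurable.mul ?_ ?_)
      · exact (Measurable.aestronglyMeasurable (by fun_prop))
      · exact hg.comp_snd
      · exact (Measurable.aestronglyMeasurable (by fun_prop))
  have h1 : mellin (fun a : ℝ => ∫ x, g x * ((Real.exp (-(Real.pi * τ x ^ 2 * a)) : ℝ) : ℂ) ∂μ) p =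
      ∫ a in Ioi 0, ∫ x, h a x ∂μ := by
    simp only [mellin, smul_eq_mul, hh, integral_const_mul]
  rw [h1, integral_integral_swap hI, ← integral_const_mul]
  refine integral_congr_ae ?_
  filter_upwards [hτ0] with x hx
  have h2 := Complex.integral_cpow_mul_exp_neg_mul_Ioi hp (hpos x hx)
  calc ∫ a in Ioi 0, h a x = ∫ a : ℝ in Ioi 0, g x * ((a : ℂ) ^ (p - 1) *
        Complex.exp (-(((Real.pi * τ x ^ 2 : ℝ) : ℂ) * a))) := by
        refine integral_congr_ae (Eventually.of_forall fun a => ?_)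
        simp only [hh]
        push_cast
        ring
    _ = g x * ((1 / ((Real.pi * τ x ^ 2 : ℝ) : ℂ)) ^ p * Complex.Gamma p) := by
        rw [integral_const_mul, h2]
    _ = _ := by
        have : (1 / ((Real.pi * τ x ^ 2 : ℝ) : ℂ)) ^ p =
            (Real.pi : ℂ) ^ (-p) * ((|τ x| : ℝ) : ℂ) ^ (-2 * p) := by
          have e1 : (1 / ((Real.pi * τ x ^ 2 : ℝ) : ℂ)) =
              ((Real.pi⁻¹ : ℝ) : ℂ) * (((|τ x| ^ 2)⁻¹ : ℝ) : ℂ) := by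
            rw [sq_abs]; push_cast; rw [one_div, mul_inv]
          rw [e1, Complex.mul_cpow_ofReal_nonneg (by positivity) (by positivity)]
          -- All bases are positive reals, so the identity of complex powers becomes a linear one
          -- between real logarithms, with no choice of branch.
          have hlog : ∀ y : ℝ, 0 < y → ∀ w : ℂ, (y : ℂ) ^ w = Complex.exp (Real.log y * w) := by
            intro y hy w
            rw [Complex.cpow_def_of_ne_zero (by exact_mod_cast hy.ne'), Complex.ofReal_log hy.le]
          have hx' := abs_pos.2 hx
          rw [hlog _ (by positivity), hlog _ (by positivity), hlog _ Real.pi_pos, hlog _ hx',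
            Real.log_inv, Real.log_inv, Real.log_pow]
          push_cast
          ring_nf
        rw [this]
        ring

theorem integral_eq_two_mul_integral_Ioi_of_even {f : ℝ → ℂ} (hf : Integrable f)
    (he : ∀ x, f (-x) = f x) : ∫ x, f x = 2 * ∫ x in Ioi 0, f x := by
  rw [← intervalIntegral.integral_Iic_add_Ioi (b := 0) hf.integrableOn hf.integrableOn]
  have := integral_comp_neg_Iic 0 f
  simp only [he, neg_zero] at this
  rw [this]
  ring

/-- `t^e exp(-π t²/b)` as a Fourier integral, for `e = 0, 1`. -/
theorem pow_mul_exp_neg_sq_eq_integral {e : ℕ} (he : e < 2) {b : ℝ} (hb : 0 < b) (t : ℝ) :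
    (t : ℂ) ^ e * ((Real.exp (-(Real.pi * t ^ 2 * b⁻¹)) : ℝ) : ℂ) =
      Complex.I ^ e * (b : ℂ) ^ ((1 / 2 : ℂ) + e) *
        ∫ s : ℝ, (s : ℂ) ^ e * ((Real.exp (-(Real.pi * s ^ 2 * b)) : ℝ) : ℂ) *
          Complex.exp (((-2 * Real.pi * s * t : ℝ) : ℂ) * Complex.I) := by
  have hb' : (b : ℂ) ≠ 0 := by exact_mod_cast hb.ne'
  set f : ℝ → ℂ := fun x => Complex.exp (-Real.pi * b * (x : ℂ) ^ 2) with hf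
  have hF := fourier_gaussian_pi (b := (b : ℂ)) (by simpa using hb)
  have hfr : ∀ s : ℝ, ((Real.exp (-(Real.pi * s ^ 2 * b)) : ℝ) : ℂ) = f s := by
    intro s; simp only [hf]; push_cast; ring_nf
  have hsqrt : (b : ℂ) ^ (1 / 2 : ℂ) ≠ 0 := by
    rw [Complex.cpow_def_of_ne_zero hb']; exact Complex.exp_ne_zero _
  have hft : ((Real.exp (-(Real.pi * t ^ 2 * b⁻¹)) : ℝ) : ℂ) = (b : ℂ) ^ (1 / 2 : ℂ) * 𝓕 f t := by
    rw [hf, hF]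
    simp only
    rw [← mul_assoc, mul_one_div_cancel hsqrt, one_mul]
    push_cast
    congr 1
    field_simp
  simp only [hfr]
  interval_cases e
  · rw [hft, Real.fourier_real_eq_integral_exp_smul]
    simp only [pow_zero, one_mul, smul_eq_mul, Nat.cast_zero, add_zero]
    congr 1
    refine integral_congr_ae (Eventually.of_forall fun s => ?_)
    simp only; ring
  · have hre : 0 < ((Real.pi : ℂ) * b).re := by
      rw [← Complex.ofReal_mul, Complex.ofReal_re]; positivity
    have hd : ∀ x : ℝ, HasDerivAt f (-2 * Real.pi * b * (x * f x)) x := by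
      intro x
      have h1 : HasDerivAt (fun y : ℂ => Complex.exp (-Real.pi * b * y ^ 2))
          (Complex.exp (-Real.pi * b * (x : ℂ) ^ 2) * (-Real.pi * b * (2 * (x : ℂ)))) (x : ℂ) := by
        have := ((hasDerivAt_pow 2 (x : ℂ)).const_mul (-Real.pi * b : ℂ)).cexp
        simpa using this
      convert h1.comp_ofReal using 1
      simp only [hf]; ring
    have hint : Integrable f := by
      have := integrable_cexp_neg_mul_sq hre
      simpa [hf] using this
    have hderiv : deriv f = fun x : ℝ => -2 * Real.pi * b * (x * f x) := funext fun x => (hd x).deriv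
    have hint' : Integrable (deriv f) := by
      rw [hderiv]
      have := (integrable_mul_cexp_neg_mul_sq hre).const_mul (-2 * Real.pi * b : ℂ)
      simpa [hf] using this
    -- For `e = 1`, `f'` is `-2πb x f(x)` and its Fourier transform is `2πi t 𝓕f(t)`; comparison of
    -- the two gives the first moment of the Gaussian.
    have h2 := congrFun (Real.fourier_deriv hint (fun x => (hd x).differentiableAt) hint') t
    rw [hderiv, Real.fourier_real_eq_integral_exp_smul] at h2
    rw [hft, pow_one, pow_one, Complex.cpow_add _ _ hb']
    simp only [Nat.cast_one, Complex.cpow_one]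
    have h3 : ∫ v : ℝ, Complex.exp (((-2 * Real.pi * v * t : ℝ) : ℂ) * Complex.I) •
        (-2 * (Real.pi : ℂ) * b * (v * f v)) = (-2 * (Real.pi : ℂ) * b) *
        ∫ s : ℝ, (s : ℂ) ^ 1 * f s *
          Complex.exp (((-2 * Real.pi * s * t : ℝ) : ℂ) * Complex.I) := by
      rw [← integral_const_mul]
      refine integral_congr_ae (Eventually.of_forall fun s => ?_)
      simp only [smul_eq_mul]; ring
    rw [h3] at h2
    have hpi : (Real.pi : ℂ) ≠ 0 := by exact_mod_cast Real.pi_ne_zero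
    set J := ∫ s : ℝ, (s : ℂ) ^ 1 * f s * Complex.exp (((-2 * Real.pi * s * t : ℝ) : ℂ) * Complex.I)
    have h4 : (t : ℂ) * 𝓕 f t = Complex.I * b * J := by
      have h5 : (2 * Real.pi * Complex.I : ℂ) ≠ 0 := by simp [hpi]
      apply mul_left_cancel₀ h5
      rw [smul_eq_mul] at h2
      linear_combination -h2 - 2 * (Real.pi : ℂ) * b * J * Complex.I_sq
    linear_combination (b : ℂ) ^ (1 / 2 : ℂ) * h4

section Ray

variable {E F : Type*} [NormedAddCommGroup E] [NormedSpace ℝ E] [NormedAddCommGroup F]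
  [NormedSpace ℂ F]

theorem SchwartzMap.isBigO_ray_atTop (H : SchwartzMap E F) {ξ : E} (hξ : ξ ≠ 0) (k : ℕ) :
    (fun s : ℝ => H (s • ξ)) =O[atTop] fun s : ℝ => s ^ (-(k : ℝ)) := by
  obtain ⟨C, hC0, hC⟩ := H.decay k 0
  have hξ' : 0 < ‖ξ‖ := norm_pos_iff.2 hξ
  refine Asymptotics.IsBigO.of_bound (C / ‖ξ‖ ^ k) ?_
  filter_upwards [eventually_gt_atTop 0] with s hs
  have h := hC (s • ξ)
  rw [norm_iteratedFDeriv_zero, norm_smul, Real.norm_of_nonneg hs.le] at h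
  rw [Real.norm_of_nonneg (by positivity), Real.rpow_neg hs.le, Real.rpow_natCast,
    ← div_eq_mul_inv, le_div_iff₀ (by positivity), le_div_iff₀ (by positivity)]
  calc ‖H (s • ξ)‖ * s ^ k * ‖ξ‖ ^ k = (s * ‖ξ‖) ^ k * ‖H (s • ξ)‖ := by rw [mul_pow]; ring
    _ ≤ C := h

theorem SchwartzMap.isBigO_ray_zero (H : SchwartzMap E F) (ξ : E) :
    (fun s : ℝ => H (s • ξ)) =O[𝓝[>] 0] fun s : ℝ => s ^ (-(0 : ℝ)) := by
  simp only [neg_zero, Real.rpow_zero]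
  have hc : Continuous (fun s : ℝ => H (s • ξ)) := H.continuous.comp (by fun_prop)
  exact (hc.tendsto 0).isBigO_one ℝ |>.mono nhdsWithin_le_nhds

theorem SchwartzMap.mellinConvergent_ray (H : SchwartzMap E F) {ξ : E} (hξ : ξ ≠ 0) {w : ℂ}
    (hw : 0 < w.re) : MellinConvergent (fun s : ℝ => H (s • ξ)) w := by
  obtain ⟨k, hk⟩ := exists_nat_gt w.re
  have hc : Continuous (fun s : ℝ => H (s • ξ)) := H.continuous.comp (by fun_prop)
  exact mellinConvergent_of_isBigO_rpow (hc.locallyIntegrable.locallyIntegrableOn _)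
    (H.isBigO_ray_atTop hξ k) hk (H.isBigO_ray_zero ξ) hw

/-- Along a ray away from the origin a Schwartz function is bounded near `0` and decays rapidly, so
`Re w > 0` is the only restriction. With `w = -z` this is what continues the transform to the left
half plane. -/
theorem SchwartzMap.differentiableAt_mellin_ray (H : SchwartzMap E F) {ξ : E} (hξ : ξ ≠ 0) {w : ℂ}
    (hw : 0 < w.re) : DifferentiableAt ℂ (mellin (fun s : ℝ => H (s • ξ))) w := by
  obtain ⟨k, hk⟩ := exists_nat_gt w.re
  have hc : Continuous (fun s : ℝ => H (s • ξ)) := H.continuous.comp (by fun_prop)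
  exact mellin_differentiableAt_of_isBigO_rpow (hc.locallyIntegrable.locallyIntegrableOn _)
    (H.isBigO_ray_atTop hξ k) hk (H.isBigO_ray_zero ξ) hw

end Ray

/-- Fourier slice formula for a Gaussian in one direction. -/
theorem SchwartzMap.integral_mul_pow_mul_exp_neg_sq {n e : ℕ} (he : e < 2)
    (G : SchwartzMap (EuclideanSpace ℝ (Fin (n + 1))) ℂ) (hG : ∀ x, G (-x) = (-1) ^ e * G x)
    (ξ : EuclideanSpace ℝ (Fin (n + 1))) {b : ℝ} (hb : 0 < b) :
    ∫ x, G x * (⟪ξ, x⟫_ℝ : ℂ) ^ e * ((Real.exp (-(Real.pi * ⟪ξ, x⟫_ℝ ^ 2 * b⁻¹)) : ℝ) : ℂ) =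
      2 * Complex.I ^ e * (b : ℂ) ^ ((1 / 2 : ℂ) + e) *
        ∫ s in Ioi (0 : ℝ), 𝓕 G (s • ξ) * (s : ℂ) ^ e *
          ((Real.exp (-(Real.pi * s ^ 2 * b)) : ℝ) : ℂ) := by
  set γ : ℝ → ℂ := fun s => (s : ℂ) ^ e * ((Real.exp (-(Real.pi * s ^ 2 * b)) : ℝ) : ℂ) with hγ
  have hγi : Integrable γ := by
    have hre : 0 < ((Real.pi : ℂ) * b).re := by
      rw [← Complex.ofReal_mul, Complex.ofReal_re]; positivity
    interval_cases e
    · refine (integrable_cexp_neg_mul_sq hre).congr (Eventually.of_forall fun s => ?_)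
      simp only [hγ]; push_cast; rw [pow_zero, one_mul]; ring_nf
    · refine (integrable_mul_cexp_neg_mul_sq hre).congr (Eventually.of_forall fun s => ?_)
      simp only [hγ]; push_cast; rw [pow_one]; ring_nf
  have hF : ∀ s : ℝ, 𝓕 G (s • ξ) = ∫ x, G x *
      Complex.exp (((-2 * Real.pi * s * ⟪ξ, x⟫_ℝ : ℝ) : ℂ) * Complex.I) := by
    intro s
    rw [SchwartzMap.fourier_coe, Real.fourier_eq']
    refine integral_congr_ae (Eventually.of_forall fun x => ?_)
    simp only [smul_eq_mul, inner_smul_right, real_inner_comm ξ x]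
    rw [mul_comm]
    push_cast
    ring_nf
  have hGi : Integrable G := G.integrable
  have hI : Integrable (Function.uncurry fun (x : EuclideanSpace ℝ (Fin (n + 1))) (s : ℝ) =>
      G x * (γ s * Complex.exp (((-2 * Real.pi * s * ⟪ξ, x⟫_ℝ : ℝ) : ℂ) * Complex.I)))
      (volume.prod volume) := by
    refine (hGi.mul_prod hγi).mono ?_ (Eventually.of_forall fun p => ?_)
    · refine AEStronglyMeasurable.mul hGi.1.comp_fst (AEStronglyMeasurable.mul hγi.1.comp_snd ?_)
      exact Continuous.aestronglyMeasurable (by fun_prop)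
    · simp only [Function.uncurry, norm_mul, Complex.norm_exp_ofReal_mul_I, mul_one, le_refl]
  calc ∫ x, G x * (⟪ξ, x⟫_ℝ : ℂ) ^ e * ((Real.exp (-(Real.pi * ⟪ξ, x⟫_ℝ ^ 2 * b⁻¹)) : ℝ) : ℂ)
      = Complex.I ^ e * (b : ℂ) ^ ((1 / 2 : ℂ) + e) * ∫ x, ∫ s : ℝ, G x * (γ s *
          Complex.exp (((-2 * Real.pi * s * ⟪ξ, x⟫_ℝ : ℝ) : ℂ) * Complex.I)) := by
        rw [← integral_const_mul]
        refine integral_congr_ae (Eventually.of_forall fun x => ?_)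
        simp only [integral_const_mul, mul_assoc (G x)]
        rw [pow_mul_exp_neg_sq_eq_integral he hb]
        ring
    -- After the order of integration is exchanged, the inner integral is the Fourier transform of
    -- `G` on the line `ℝξ`.
    _ = Complex.I ^ e * (b : ℂ) ^ ((1 / 2 : ℂ) + e) * ∫ s : ℝ, γ s * 𝓕 G (s • ξ) := by
        rw [integral_integral_swap hI]
        congr 1
        refine integral_congr_ae (Eventually.of_forall fun s => ?_)
        simp only [hF, ← integral_const_mul]
        refine integral_congr_ae (Eventually.of_forall fun x => ?_)
        simp only
        ring
    _ = Complex.I ^ e * (b : ℂ) ^ ((1 / 2 : ℂ) + e) * (2 * ∫ s in Ioi (0 : ℝ), γ s * 𝓕 G (s • ξ)) := by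
        congr 1
        -- `γ` and `s ↦ 𝓕 G (s • ξ)` both have parity `e`, so their product is even.
        refine integral_eq_two_mul_integral_Ioi_of_even ?_ fun s => ?_
        · obtain ⟨C, -, hC⟩ := (𝓕 G).decay 0 0
          refine hγi.mul_bdd (c := C) ?_ (Eventually.of_forall fun s => ?_)
          · exact ((𝓕 G).continuous.comp (by fun_prop)).aestronglyMeasurable
          · simpa using hC (s • ξ)
        · have h1 : 𝓕 G ((-s) • ξ) = (-1) ^ e * 𝓕 G (s • ξ) := by
            rw [hF, hF, ← integral_const_mul, ← integral_neg_eq_self]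
            refine integral_congr_ae (Eventually.of_forall fun x => ?_)
            simp only [hG, inner_neg_right]
            ring_nf
          rw [h1]
          simp only [hγ, neg_sq, Complex.ofReal_neg]
          rw [neg_pow]
          have : ((-1 : ℂ) ^ e) * (-1) ^ e = 1 := by rw [← mul_pow]; simp
          linear_combination ((s : ℂ) ^ e * ((Real.exp (-(Real.pi * s ^ 2 * b)) : ℝ) : ℂ) * 𝓕 G (s • ξ)) * this
    _ = _ := by
        rw [← mul_assoc, mul_comm _ (2 : ℂ), ← mul_assoc 2]
        congr 1
        refine integral_congr_ae (Eventually.of_forall fun s => ?_)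
        simp only [hγ]
        ring

/-- The functional equation of the one-dimensional zeta integrals, in the direction `ξ`. -/
theorem SchwartzMap.integral_mul_parityKernel {n e : ℕ} (he : e < 2)
    (G : SchwartzMap (EuclideanSpace ℝ (Fin (n + 1))) ℂ) (hG : ∀ x, G (-x) = (-1) ^ e * G x)
    {ξ : EuclideanSpace ℝ (Fin (n + 1))} (hξ : ‖ξ‖ = 1) {z : ℂ} (hz : -1 < z.re) (hz' : z.re < 0) :
    ∫ x, G x * parityKernel e z ⟪ξ, x⟫_ℝ =
      2 * Complex.I ^ e * (Real.pi : ℂ) ^ (-(1 / 2) - z) / Complex.Gamma ((e - z) / 2) *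
        mellin (fun s : ℝ => 𝓕 G (s • ξ)) (-z) := by
  -- The exponents are chosen so that `t^e |t|^(-2p)` is the raw kernel and `s^e s^(-2q) =
  -- s^(-z-1)`. For both parities the bounds on `Re z` make the real parts of `p` and `q` positive.
  set p : ℂ := (e - z) / 2 with hp
  set q : ℂ := (z + 1 + e) / 2 with hq
  have hre : ∀ w : ℂ, (w / 2).re = w.re / 2 := fun w => by simp
  have hpre : p.re = (e - z.re) / 2 := by rw [hp, hre]; simp
  have hqre : q.re = (z.re + 1 + e) / 2 := by rw [hq, hre]; simp
  have he0 : (0 : ℝ) ≤ e := Nat.cast_nonneg e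
  have hp0 : 0 < p.re := by rw [hpre]; linarith
  have hq0 : 0 < q.re := by rw [hqre]; linarith
  have hξ0 : ξ ≠ 0 := by intro h; simp [h] at hξ
  have hne := ae_inner_ne_zero hξ
  have h1 := mellin_integral_mul_exp_neg_sq (μ := volume)
    (g := fun x => G x * (⟪ξ, x⟫_ℝ : ℂ) ^ e) (τ := fun x => ⟪ξ, x⟫_ℝ)
    (Continuous.aestronglyMeasurable (G.continuous.mul (by fun_prop))) (by fun_prop) hne hp0 (by
      refine (G.integrable_mul_abs_inner_rpow hz (by linarith) hξ).congr ?_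
      filter_upwards [hne] with x hx
      rw [norm_mul, norm_pow, Complex.norm_real, Real.norm_eq_abs, mul_assoc, ← Real.rpow_natCast,
        ← Real.rpow_add (abs_pos.2 hx), hpre]
      ring_nf)
  have h2 := mellin_integral_mul_exp_neg_sq (μ := volume.restrict (Ioi (0 : ℝ)))
    (g := fun s => 𝓕 G (s • ξ) * (s : ℂ) ^ e) (τ := fun s => s)
    (Continuous.aestronglyMeasurable (((𝓕 G).continuous.comp (by fun_prop)).mul (by fun_prop)))
    measurable_id (by
      filter_upwards [ae_restrict_mem measurableSet_Ioi] with s hs using (ne_of_gt hs)) hq0 (by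
      have := ((𝓕 G).mellinConvergent_ray hξ0 (w := -z) (by simpa using hz')).norm
      refine this.congr ?_
      filter_upwards [ae_restrict_mem measurableSet_Ioi] with s hs
      have hs : 0 < s := hs
      rw [norm_smul, Complex.norm_cpow_eq_rpow_re_of_pos hs, norm_mul, norm_pow, Complex.norm_real,
        Real.norm_of_nonneg hs.le, abs_of_pos hs, mul_assoc, ← Real.rpow_natCast,
        ← Real.rpow_add hs, hqre, mul_comm]
      congr 2
      simp
      ring)
  -- The Mellin transform at `p` of the Gaussian identity with `b = a⁻¹`: inversion changes `p` to
  -- `-p`, and the factor `b^(1/2+e)` shifts it to `q`.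
  have h3 : mellin (fun a : ℝ => ∫ x, G x * (⟪ξ, x⟫_ℝ : ℂ) ^ e *
      ((Real.exp (-(Real.pi * ⟪ξ, x⟫_ℝ ^ 2 * a)) : ℝ) : ℂ)) p =
      2 * Complex.I ^ e * mellin (fun b : ℝ => ∫ s in Ioi (0 : ℝ), 𝓕 G (s • ξ) * (s : ℂ) ^ e *
          ((Real.exp (-(Real.pi * s ^ 2 * b)) : ℝ) : ℂ)) q := by
    have hqp : q = -p + (1 / 2 + e) := by rw [hp, hq]; ring
    rw [hqp, ← mellin_cpow_smul, ← neg_neg p, ← mellin_comp_inv, neg_neg, ← smul_eq_mul (2 * _),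
      ← mellin_const_smul]
    refine setIntegral_congr_fun measurableSet_Ioi fun b hb => ?_
    simp only
    rw [G.integral_mul_pow_mul_exp_neg_sq he hG ξ hb]
    simp only [smul_eq_mul]
    ring
  rw [h1, h2] at h3
  have h4 : ∫ x, G x * (⟪ξ, x⟫_ℝ : ℂ) ^ e * ((|⟪ξ, x⟫_ℝ| : ℝ) : ℂ) ^ (-2 * p) =
      ∫ x, G x * rawKernel e z ⟪ξ, x⟫_ℝ := by
    refine integral_congr_ae ?_
    filter_upwards [hne] with x hx
    have hx' : ((|⟪ξ, x⟫_ℝ| : ℝ) : ℂ) ≠ 0 := by simpa using hx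
    have hs : (⟪ξ, x⟫_ℝ : ℂ) = ((Real.sign ⟪ξ, x⟫_ℝ : ℝ) : ℂ) * ((|⟪ξ, x⟫_ℝ| : ℝ) : ℂ) := by
      rw [← Complex.ofReal_mul, Complex.ofReal_inj]
      rcases hx.lt_or_gt with h | h
      · rw [Real.sign_of_neg h, abs_of_neg h]; ring
      · rw [Real.sign_of_pos h, abs_of_pos h]; ring
    have hz2 : -2 * p = z - e := by rw [hp]; ring
    conv_lhs => rw [hs]
    rw [rawKernel, hz2, Complex.cpow_sub _ _ hx', Complex.cpow_natCast, mul_pow]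
    field_simp
  have h5 : ∫ s in Ioi (0 : ℝ), 𝓕 G (s • ξ) * (s : ℂ) ^ e * ((|s| : ℝ) : ℂ) ^ (-2 * q) =
      mellin (fun s : ℝ => 𝓕 G (s • ξ)) (-z) := by
    refine setIntegral_congr_fun measurableSet_Ioi fun s hs => ?_
    have hs : 0 < s := hs
    have hs' : (s : ℂ) ≠ 0 := by exact_mod_cast hs.ne'
    have hz2 : -2 * q = (-z - 1) - e := by rw [hq]; ring
    simp only [abs_of_pos hs, smul_eq_mul]
    rw [hz2, Complex.cpow_sub _ _ hs', Complex.cpow_natCast]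
    field_simp
  rw [h4, h5] at h3
  have h6 : ∫ x, G x * parityKernel e z ⟪ξ, x⟫_ℝ =
      (∫ x, G x * rawKernel e z ⟪ξ, x⟫_ℝ) / Complex.Gamma q := by
    rw [← integral_div]
    refine integral_congr_ae (Eventually.of_forall fun x => ?_)
    simp only [parityKernel]
    ring
  rw [h6]
  have hΓp := Complex.Gamma_ne_zero_of_re_pos hp0
  have hΓq := Complex.Gamma_ne_zero_of_re_pos hq0
  have hpi : (Real.pi : ℂ) ≠ 0 := by exact_mod_cast Real.pi_ne_zero
  have hpow : (Real.pi : ℂ) ^ (-(1 / 2) - z) * (Real.pi : ℂ) ^ (-p) = (Real.pi : ℂ) ^ (-q) := by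
    rw [← Complex.cpow_add _ _ hpi]
    congr 1
    rw [hp, hq]
    ring
  have hpip : (Real.pi : ℂ) ^ (-p) ≠ 0 := by simp [Complex.cpow_eq_zero_iff, hpi]
  rw [← hpow] at h3
  generalize (Real.pi : ℂ) ^ (-(1 / 2) - z) = A at h3 ⊢
  field_simp
  apply mul_left_cancel₀ hpip
  linear_combination h3

/-! ### Radial extensions of functions on the sphere. -/

/-- A smooth bump function supported in `[1/2, 3/2]`. -/
noncomputable def radialBump : ContDiffBump (1 : ℝ) := ⟨1 / 4, 1 / 2, by norm_num, by norm_num⟩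

theorem radialBump_eq_zero {r : ℝ} (hr : r ≤ 1 / 2 ∨ 3 / 2 ≤ r) : radialBump r = 0 := by
  apply radialBump.zero_of_le_dist
  rw [Real.dist_eq]
  change (1 / 2 : ℝ) ≤ _
  rcases hr with h | h
  · rw [abs_of_nonpos (by linarith)]; linarith
  · rw [abs_of_nonneg (by linarith)]; linarith

/-- The radial projection onto the unit sphere, with an arbitrary value at the origin. -/
noncomputable def sphereProj (n : ℕ) (x : EuclideanSpace ℝ (Fin (n + 1))) : UnitSphere n :=
  open Classical in
  if h : x = 0 then ⟨EuclideanSpace.single 0 1, by simp⟩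
  else ⟨‖x‖⁻¹ • x, by simp [norm_smul, h]⟩

theorem coe_sphereProj {n : ℕ} {x : EuclideanSpace ℝ (Fin (n + 1))} (hx : x ≠ 0) :
    (sphereProj n x : EuclideanSpace ℝ (Fin (n + 1))) = ‖x‖⁻¹ • x := by
  simp [sphereProj, hx]

theorem sphereProj_smul {n : ℕ} {r : ℝ} (hr : 0 < r) (η : UnitSphere n) :
    sphereProj n (r • (η : EuclideanSpace ℝ (Fin (n + 1)))) = η := by
  apply Subtype.ext
  have hη : (η : EuclideanSpace ℝ (Fin (n + 1))) ≠ 0 := ne_zero_of_mem_unit_sphere η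
  rw [coe_sphereProj (smul_ne_zero hr.ne' hη), norm_smul, norm_eq_of_mem_sphere, mul_one,
    Real.norm_of_nonneg hr.le, smul_smul, inv_mul_cancel₀ hr.ne', one_smul]

/-- Passage from smoothness on the manifold to ordinary calculus: `x ↦ x/|x|` is smooth off the
origin as a map into the ambient space, hence also as a map into the sphere. -/
theorem SmoothOnSphere.contDiffAt_comp_sphereProj {n : ℕ} {f : UnitSphere n → ℂ}
    (hf : SmoothOnSphere n f) {x : EuclideanSpace ℝ (Fin (n + 1))} (hx : x ≠ 0) :
    ContDiffAt ℝ ∞ (fun y => f (sphereProj n y)) x := by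
  have : Fact (Module.finrank ℝ (EuclideanSpace ℝ (Fin (n + 1))) = n + 1) := ⟨by simp⟩
  let U : TopologicalSpace.Opens (EuclideanSpace ℝ (Fin (n + 1))) := ⟨{0}ᶜ, isOpen_compl_singleton⟩
  have hg : ContMDiff 𝓘(ℝ, EuclideanSpace ℝ (Fin (n + 1))) 𝓘(ℝ, EuclideanSpace ℝ (Fin (n + 1))) ∞
      (fun y : U => (sphereProj n (y : EuclideanSpace ℝ (Fin (n + 1))) :
        EuclideanSpace ℝ (Fin (n + 1)))) := by
    intro y
    have hy : (y : EuclideanSpace ℝ (Fin (n + 1))) ≠ 0 := y.2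
    refine contMDiffAt_subtype_iff (f := fun y => (sphereProj n y : EuclideanSpace ℝ (Fin (n + 1)))).2 ?_
    rw [contMDiffAt_iff_contDiffAt]
    have : ContDiffAt ℝ ∞ (fun y : EuclideanSpace ℝ (Fin (n + 1)) => ‖y‖⁻¹ • y) y :=
      ((contDiffAt_norm ℝ hy).inv (norm_ne_zero_iff.2 hy)).smul contDiffAt_id
    refine this.congr_of_eventuallyEq ?_
    filter_upwards [isOpen_compl_singleton.mem_nhds hy] with w hw using coe_sphereProj hw
  have hc := ContMDiff.codRestrict_sphere (n := n) hg (fun y => (sphereProj n y).2)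
  have h := ContMDiff.comp (g := f) hf hc
  have h2 := contMDiffAt_subtype_iff (f := fun y => f (sphereProj n y)) (x := (⟨x, hx⟩ : U)).1
    (h ⟨x, hx⟩)
  exact contMDiffAt_iff_contDiffAt.1 h2

theorem SmoothOnSphere.continuous {n : ℕ} {f : UnitSphere n → ℂ} (hf : SmoothOnSphere n f) :
    Continuous f :=
  ContMDiff.continuous hf

theorem smoothOnSphere_of_contDiffAt {n : ℕ} {f : UnitSphere n → ℂ}
    (h : ∀ ξ : UnitSphere n, ∃ g : EuclideanSpace ℝ (Fin (n + 1)) → ℂ,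
      ContDiffAt ℝ ∞ g ξ ∧ ∀ᶠ η : UnitSphere n in 𝓝 ξ, f η = g η) : SmoothOnSphere n f := by
  have : Fact (Module.finrank ℝ (EuclideanSpace ℝ (Fin (n + 1))) = n + 1) := ⟨by simp⟩
  intro ξ
  obtain ⟨g, hg, hfg⟩ := h ξ
  have h1 := (contMDiffAt_iff_contDiffAt.2 hg).comp ξ
    ((contMDiff_coe_sphere (n := n) (E := EuclideanSpace ℝ (Fin (n + 1)))).contMDiffAt (x := ξ))
  exact h1.congr_of_eventuallyEq hfg

/-- The extension `b(|x|) |x|^p f(x/|x|)` of a function on the sphere. -/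
noncomputable def radialExtension (n : ℕ) (p : ℂ) (f : UnitSphere n → ℂ)
    (x : EuclideanSpace ℝ (Fin (n + 1))) : ℂ :=
  (radialBump ‖x‖ : ℂ) * ((‖x‖ : ℝ) : ℂ) ^ p * f (sphereProj n x)

theorem radialExtension_smul {n : ℕ} (p : ℂ) (f : UnitSphere n → ℂ) {r : ℝ} (hr : 0 < r)
    (η : UnitSphere n) :
    radialExtension n p f (r • (η : EuclideanSpace ℝ (Fin (n + 1)))) =
      (radialBump r : ℂ) * (r : ℂ) ^ p * f η := by
  rw [radialExtension, sphereProj_smul hr, norm_smul, norm_eq_of_mem_sphere, mul_one,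
    Real.norm_of_nonneg hr.le]

theorem radialExtension_eq_zero {n : ℕ} (p : ℂ) (f : UnitSphere n → ℂ)
    {x : EuclideanSpace ℝ (Fin (n + 1))} (hx : ‖x‖ ≤ 1 / 2 ∨ 3 / 2 ≤ ‖x‖) :
    radialExtension n p f x = 0 := by
  simp [radialExtension, radialBump_eq_zero hx]

theorem hasCompactSupport_radialExtension {n : ℕ} (p : ℂ) (f : UnitSphere n → ℂ) :
    HasCompactSupport (radialExtension n p f) := by
  refine HasCompactSupport.of_support_subset_isCompact
    (isCompact_closedBall (0 : EuclideanSpace ℝ (Fin (n + 1))) (3 / 2)) fun x hx => ?_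
  by_contra h
  rw [mem_closedBall_zero_iff, not_le] at h
  exact hx (radialExtension_eq_zero p f (Or.inr h.le))

theorem SmoothOnSphere.contDiff_radialExtension {n : ℕ} {f : UnitSphere n → ℂ}
    (hf : SmoothOnSphere n f) (p : ℂ) : ContDiff ℝ ∞ (radialExtension n p f) := by
  rw [contDiff_iff_contDiffAt]
  intro x
  by_cases hx : x = 0
  · refine (contDiffAt_const (c := (0 : ℂ))).congr_of_eventuallyEq ?_
    filter_upwards [ball_mem_nhds x (by norm_num : (0 : ℝ) < 1 / 2)] with y hy
    rw [hx, mem_ball_zero_iff] at hy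
    exact radialExtension_eq_zero p f (Or.inl hy.le)
  · have hn := contDiffAt_norm ℝ (n := ∞) hx
    have h1 : ContDiffAt ℝ ∞ (fun y : EuclideanSpace ℝ (Fin (n + 1)) => (radialBump ‖y‖ : ℂ)) x :=
      Complex.ofRealCLM.contDiff.contDiffAt.comp x (radialBump.contDiffAt.comp x hn)
    have h2 : ContDiffAt ℝ ∞ (fun y : EuclideanSpace ℝ (Fin (n + 1)) => ((‖y‖ : ℝ) : ℂ) ^ p) x := by
      have h3 : ContDiffAt ℝ ∞ (fun y : EuclideanSpace ℝ (Fin (n + 1)) =>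
          Complex.exp ((Real.log ‖y‖ : ℝ) * p)) x := by
        have h4 : ContDiffAt ℝ ∞ (fun y : EuclideanSpace ℝ (Fin (n + 1)) => ((Real.log ‖y‖ : ℝ) : ℂ)) x :=
          Complex.ofRealCLM.contDiff.contDiffAt.comp x (hn.log (norm_ne_zero_iff.2 hx))
        exact (h4.mul contDiffAt_const).cexp
      refine h3.congr_of_eventuallyEq ?_
      filter_upwards [isOpen_compl_singleton.mem_nhds hx] with y hy
      have hy' : 0 < ‖y‖ := norm_pos_iff.2 hy
      rw [Complex.cpow_def_of_ne_zero (by exact_mod_cast hy'.ne'), Complex.ofReal_log hy'.le]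
    exact (h1.mul h2).mul (hf.contDiffAt_comp_sphereProj hx)

theorem radialExtension_neg {n e : ℕ} {f : UnitSphere n → ℂ} (hf : ∀ η, f (-η) = (-1) ^ e * f η)
    (p : ℂ) (x : EuclideanSpace ℝ (Fin (n + 1))) :
    radialExtension n p f (-x) = (-1) ^ e * radialExtension n p f x := by
  by_cases hx : x = 0
  · rw [radialExtension_eq_zero, radialExtension_eq_zero, mul_zero] <;> simp [hx]
  · have h : sphereProj n (-x) = -sphereProj n x := by
      apply Subtype.ext
      rw [coe_sphereProj (neg_ne_zero.2 hx), coe_neg_sphere, coe_sphereProj hx, norm_neg, smul_neg]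
    rw [radialExtension, h, hf, norm_neg, radialExtension]
    ring

/-- `radialExtension` as a Schwartz function. -/
noncomputable def SmoothOnSphere.schwartz {n : ℕ} {f : UnitSphere n → ℂ}
    (hf : SmoothOnSphere n f) (p : ℂ) : SchwartzMap (EuclideanSpace ℝ (Fin (n + 1))) ℂ :=
  (hasCompactSupport_radialExtension p f).toSchwartzMap (hf.contDiff_radialExtension p)

theorem SmoothOnSphere.schwartz_apply {n : ℕ} {f : UnitSphere n → ℂ} (hf : SmoothOnSphere n f)
    (p : ℂ) (x : EuclideanSpace ℝ (Fin (n + 1))) : hf.schwartz p x = radialExtension n p f x := rfl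

/-- `∫_0^∞ b(r) r^(p + z + n) dr`. -/
noncomputable def radialMoment (n : ℕ) (p z : ℂ) : ℂ :=
  mellin (fun r => (radialBump r : ℂ)) (p + z + n + 1)

/-- The bump vanishes near `0` and near infinity, so no exponent is excluded. -/
theorem differentiable_mellin_radialBump :
    Differentiable ℂ (mellin (fun r => (radialBump r : ℂ))) := by
  intro s
  have hc : Continuous (fun r => (radialBump r : ℂ)) :=
    Complex.continuous_ofReal.comp radialBump.continuous
  refine mellin_differentiableAt_of_isBigO_rpow (a := s.re + 1) (b := s.re - 1)
    (hc.locallyIntegrable.locallyIntegrableOn _) ?_ (by linarith) ?_ (by linarith)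
  · refine Asymptotics.IsBigO.of_bound 0 ?_
    filter_upwards [eventually_ge_atTop (3 / 2 : ℝ)] with r hr
    simp [radialBump_eq_zero (Or.inr hr)]
  · refine Asymptotics.IsBigO.of_bound 0 ?_
    filter_upwards [mem_nhdsWithin_of_mem_nhds (Iio_mem_nhds (by norm_num : (0 : ℝ) < 1 / 2))]
      with r hr
    simp [radialBump_eq_zero (Or.inl (le_of_lt hr))]

theorem differentiable_radialMoment (n : ℕ) (p : ℂ) : Differentiable ℂ (radialMoment n p) :=
  differentiable_mellin_radialBump.comp (by fun_prop : Differentiable ℂ fun z : ℂ => p + z + n + 1)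

/-- The exponent `p = -z - n` cancels the homogeneity `z` of the kernel and the Jacobian `r^n`, and
leaves the positive integral of the bump. This is why the extension carries a free exponent `p`: it
can be matched to the point `z` where division is needed. -/
theorem radialMoment_ne_zero (n : ℕ) (z : ℂ) : radialMoment n (-z - n) z ≠ 0 := by
  have h1 : -z - n + z + n + 1 = 1 := by ring
  rw [radialMoment, h1, mellin]
  have h2 : ∫ t : ℝ in Ioi 0, (t : ℂ) ^ ((1 : ℂ) - 1) • (radialBump t : ℂ) =
      ((∫ t : ℝ, radialBump t : ℝ) : ℂ) := by
    rw [← integral_complex_ofReal, ← integral_indicator measurableSet_Ioi]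
    refine integral_congr_ae (Eventually.of_forall fun t => ?_)
    simp only [sub_self, Complex.cpow_zero, one_smul]
    by_cases ht : t ∈ Ioi (0 : ℝ)
    · rw [indicator_of_mem ht]
    · rw [indicator_of_notMem ht, radialBump_eq_zero, Complex.ofReal_zero]
      left
      have : t ≤ 0 := not_lt.1 ht
      linarith
  rw [h2]
  exact_mod_cast radialBump.integral_pos.ne'

/-- Integration of the radial extension against a homogeneous kernel. -/
theorem integral_radialExtension_mul_parityKernel (n e : ℕ) (p z : ℂ) (f : UnitSphere n → ℂ)
    (ξ : UnitSphere n) :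
    ∫ x, radialExtension n p f x * parityKernel e z ⟪(ξ : EuclideanSpace ℝ (Fin (n + 1))), x⟫_ℝ =
      radialMoment n p z * sphereIntegral n (parityKernel e) f z ξ := by
  rw [integral_eq_integral_sphere_prod]
  have h : ∀ q : UnitSphere n × Ioi (0 : ℝ), radialExtension n p f
      ((q.2 : ℝ) • (q.1 : EuclideanSpace ℝ (Fin (n + 1)))) * parityKernel e z
        ⟪(ξ : EuclideanSpace ℝ (Fin (n + 1))), (q.2 : ℝ) • (q.1 : EuclideanSpace ℝ (Fin (n + 1)))⟫_ℝ =
      sphereIntegrand n (parityKernel e) f z ξ q.1 *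
        ((radialBump (q.2 : ℝ) : ℂ) * ((q.2 : ℝ) : ℂ) ^ p * ((q.2 : ℝ) : ℂ) ^ z) := by
    intro q
    have hq : 0 < (q.2 : ℝ) := q.2.2
    rw [radialExtension_smul p f hq, inner_smul_right, parityKernel, rawKernel_mul e z hq,
      sphereIntegrand, parityKernel]
    ring
  simp_rw [h]
  rw [integral_prod_mul (fun η => sphereIntegrand n (parityKernel e) f z ξ η)
    (fun r : Ioi (0 : ℝ) => (radialBump (r : ℝ) : ℂ) * ((r : ℝ) : ℂ) ^ p * ((r : ℝ) : ℂ) ^ z),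
    integral_volumeIoiPow n (fun r => (radialBump r : ℂ) * (r : ℂ) ^ p * (r : ℂ) ^ z), mul_comm]
  congr 1
  rw [radialMoment, mellin]
  refine setIntegral_congr_fun measurableSet_Ioi fun r hr => ?_
  have hr' : (r : ℂ) ≠ 0 := by exact_mod_cast (ne_of_gt hr)
  simp only [smul_eq_mul]
  have : p + z + n + 1 - 1 = p + z + n := by ring
  rw [this, Complex.cpow_add _ _ hr', Complex.cpow_add _ _ hr', Complex.cpow_natCast]
  ring

/-! ### The transform for `Re z > -1`. -/

theorem isOpen_re_gt_neg_one : IsOpen {z : ℂ | -1 < z.re} := isOpen_lt continuous_const Complex.continuous_re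

theorem norm_rawKernel_inner_le {n e : ℕ} {a : ℝ} {z : ℂ} (hz : a ≤ z.re) (ξ η : UnitSphere n)
    (h : ⟪(ξ : EuclideanSpace ℝ (Fin (n + 1))), (η : EuclideanSpace ℝ (Fin (n + 1)))⟫_ℝ ≠ 0) :
    ‖rawKernel e z ⟪(ξ : EuclideanSpace ℝ (Fin (n + 1))), (η : EuclideanSpace ℝ (Fin (n + 1)))⟫_ℝ‖ ≤
      |⟪(ξ : EuclideanSpace ℝ (Fin (n + 1))), (η : EuclideanSpace ℝ (Fin (n + 1)))⟫_ℝ| ^ a := by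
  refine (norm_rawKernel_le e z h).trans
    (Real.rpow_le_rpow_of_exponent_ge (abs_pos.2 h) ?_ hz)
  simpa using abs_real_inner_le_norm (ξ : EuclideanSpace ℝ (Fin (n + 1))) η

theorem exists_norm_le_of_continuous {n : ℕ} {f : UnitSphere n → ℂ} (hf : Continuous f) :
    ∃ C, 0 ≤ C ∧ ∀ η, ‖f η‖ ≤ C := by
  obtain ⟨C, hC⟩ := (isCompact_range hf).isBounded.exists_norm_le
  exact ⟨max C 0, le_max_right _ _, fun η => (hC _ (mem_range_self η)).trans (le_max_left _ _)⟩

/-- A locally uniform bound for the integrals with the kernel `|t|^z (sign t)^e`. -/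
theorem ae_norm_mul_rawKernel_le {n : ℕ} (e : ℕ) {f : UnitSphere n → ℂ} {C : ℝ}
    (hC : ∀ η, ‖f η‖ ≤ C) {a : ℝ} (ξ : UnitSphere n) :
    ∀ᵐ η : UnitSphere n ∂(surfaceMeasure n), ∀ z ∈ {z : ℂ | a ≤ z.re},
      ‖f η * rawKernel e z ⟪(ξ : EuclideanSpace ℝ (Fin (n + 1))),
        (η : EuclideanSpace ℝ (Fin (n + 1)))⟫_ℝ‖ ≤
      C * |⟪(ξ : EuclideanSpace ℝ (Fin (n + 1))), (η : EuclideanSpace ℝ (Fin (n + 1)))⟫_ℝ| ^ a := by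
  filter_upwards [surfaceMeasure_inner_eq_zero n ξ] with η hη z hz
  rw [norm_mul]
  exact mul_le_mul (hC η) (norm_rawKernel_inner_le hz ξ η hη) (norm_nonneg _)
    ((norm_nonneg _).trans (hC η))

theorem aestronglyMeasurable_mul_rawKernel {n : ℕ} (e : ℕ) {f : UnitSphere n → ℂ}
    (hf : Continuous f) (z : ℂ) (ξ : UnitSphere n) :
    AEStronglyMeasurable (fun η : UnitSphere n => f η * rawKernel e z
      ⟪(ξ : EuclideanSpace ℝ (Fin (n + 1))), (η : EuclideanSpace ℝ (Fin (n + 1)))⟫_ℝ)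
      (surfaceMeasure n) :=
  (hf.measurable.mul ((measurable_rawKernel e z).comp (by fun_prop))).aestronglyMeasurable

theorem sphereIntegral_parityKernel (n e : ℕ) (f : UnitSphere n → ℂ) (z : ℂ) (ξ : UnitSphere n) :
    sphereIntegral n (parityKernel e) f z ξ =
      (∫ η : UnitSphere n, f η * rawKernel e z ⟪(ξ : EuclideanSpace ℝ (Fin (n + 1))),
        (η : EuclideanSpace ℝ (Fin (n + 1)))⟫_ℝ ∂(surfaceMeasure n)) *
        (Complex.Gamma ((z + 1 + e) / 2))⁻¹ := by
  rw [sphereIntegral, ← integral_mul_const]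
  refine integral_congr_ae (Eventually.of_forall fun η => ?_)
  simp only [sphereIntegrand, parityKernel]
  ring

theorem differentiable_inv_Gamma_parity (e : ℕ) :
    Differentiable ℂ fun z : ℂ => (Complex.Gamma ((z + 1 + e) / 2))⁻¹ :=
  Complex.differentiable_one_div_Gamma.comp
    (by fun_prop : Differentiable ℂ fun z : ℂ => (z + 1 + e) / 2)

theorem integrable_mul_rawKernel {n : ℕ} (e : ℕ) {f : UnitSphere n → ℂ} (hf : Continuous f)
    {z : ℂ} (hz : -1 < z.re) (ξ : UnitSphere n) :
    Integrable (fun η : UnitSphere n => f η * rawKernel e z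
      ⟪(ξ : EuclideanSpace ℝ (Fin (n + 1))), (η : EuclideanSpace ℝ (Fin (n + 1)))⟫_ℝ)
      (surfaceMeasure n) := by
  obtain ⟨C, hC0, hC⟩ := exists_norm_le_of_continuous hf
  obtain ⟨D, hD⟩ := exists_bound_integral_abs_inner_rpow n hz
  refine ((hD ξ).1.const_mul C).mono' (aestronglyMeasurable_mul_rawKernel e hf z ξ) ?_
  filter_upwards [ae_norm_mul_rawKernel_le e hC (a := z.re) ξ] with η hη using hη z le_rfl

theorem integrable_sphereIntegrand_parityKernel {n : ℕ} (e : ℕ) {f : UnitSphere n → ℂ}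
    (hf : Continuous f) {z : ℂ} (hz : -1 < z.re) (ξ : UnitSphere n) :
    Integrable (sphereIntegrand n (parityKernel e) f z ξ) (surfaceMeasure n) := by
  refine ((integrable_mul_rawKernel e hf hz ξ).mul_const
    (Complex.Gamma ((z + 1 + e) / 2))⁻¹).congr (Eventually.of_forall fun η => ?_)
  simp only [sphereIntegrand, parityKernel]
  ring

theorem differentiableOn_sphereIntegral {n : ℕ} (e : ℕ) {f : UnitSphere n → ℂ}
    (hf : Continuous f) (ξ : UnitSphere n) :
    DifferentiableOn ℂ (fun z => sphereIntegral n (parityKernel e) f z ξ) {z | -1 < z.re} := by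
  simp only [sphereIntegral_parityKernel]
  refine DifferentiableOn.mul ?_ (differentiable_inv_Gamma_parity e).differentiableOn
  refine differentiableOn_integral_of_locally_dominated isOpen_re_gt_neg_one
    (fun z _ => aestronglyMeasurable_mul_rawKernel e hf z ξ) ?_ fun z hz => ?_
  · filter_upwards [surfaceMeasure_inner_eq_zero n ξ] with η hη
    exact ((differentiable_rawKernel e hη).const_mul (f η)).differentiableOn
  · have hz : -1 < z.re := hz
    obtain ⟨C, hC0, hC⟩ := exists_norm_le_of_continuous hf
    obtain ⟨a, ha, haz⟩ := exists_between hz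
    obtain ⟨D, hD⟩ := exists_bound_integral_abs_inner_rpow n ha
    exact ⟨_, (hD ξ).1.const_mul C, {w | a ≤ w.re},
      Complex.continuous_re.continuousAt.preimage_mem_nhds (Ici_mem_nhds haz),
      ae_norm_mul_rawKernel_le e hC ξ⟩

/-! ### Analytic continuation. -/

/-- The constant `2 i^e π^(-1/2-z) / Γ((e-z)/2)` of the functional equation. -/
noncomputable def fourierFactor (e : ℕ) (z : ℂ) : ℂ :=
  2 * Complex.I ^ e * (Real.pi : ℂ) ^ (-(1 / 2) - z) / Complex.Gamma ((e - z) / 2)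

theorem differentiable_fourierFactor (e : ℕ) : Differentiable ℂ (fourierFactor e) := by
  have hpi : (Real.pi : ℂ) ≠ 0 := by exact_mod_cast Real.pi_ne_zero
  have h1 : Differentiable ℂ fun z : ℂ => (Real.pi : ℂ) ^ (-(1 / 2) - z) := fun z =>
    DifferentiableAt.const_cpow (by fun_prop) (Or.inl hpi)
  have h2 : Differentiable ℂ fun z : ℂ => (Complex.Gamma ((e - z) / 2))⁻¹ :=
    Complex.differentiable_one_div_Gamma.comp (by fun_prop : Differentiable ℂ fun z : ℂ => (e - z) / 2)
  unfold fourierFactor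
  simp only [div_eq_mul_inv _ (Complex.Gamma _)]
  exact (h1.const_mul _).mul h2

/-- The right hand side of the functional equation for `SchwartzMap.integral_mul_parityKernel`. -/
noncomputable def fourierSide {n : ℕ} (e : ℕ) (G : SchwartzMap (EuclideanSpace ℝ (Fin (n + 1))) ℂ)
    (ξ : EuclideanSpace ℝ (Fin (n + 1))) (z : ℂ) : ℂ :=
  fourierFactor e z * mellin (fun s : ℝ => 𝓕 G (s • ξ)) (-z)

theorem differentiableAt_fourierSide {n : ℕ} (e : ℕ)
    (G : SchwartzMap (EuclideanSpace ℝ (Fin (n + 1))) ℂ)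
    {ξ : EuclideanSpace ℝ (Fin (n + 1))} (hξ : ξ ≠ 0) {z : ℂ} (hz : z.re < 0) :
    DifferentiableAt ℂ (fourierSide e G ξ) z := by
  refine (differentiable_fourierFactor e z).mul ?_
  exact ((𝓕 G).differentiableAt_mellin_ray hξ (w := -z) (by simpa using hz)).comp z
    differentiableAt_id.neg

variable {n e : ℕ} {f : UnitSphere n → ℂ}

/-- One integral over `ℝ^(n+1)`, evaluated in polar coordinates on the left and by the functional
equation on the right. -/
theorem radialMoment_mul_sphereIntegral (he : e < 2) (hf : SmoothOnSphere n f)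
    (hfe : ∀ η, f (-η) = (-1) ^ e * f η) (p : ℂ) {z : ℂ} (hz : -1 < z.re) (hz' : z.re < 0)
    (ξ : UnitSphere n) :
    radialMoment n p z * sphereIntegral n (parityKernel e) f z ξ = fourierSide e (hf.schwartz p) ξ z := by
  rw [← integral_radialExtension_mul_parityKernel]
  exact (hf.schwartz p).integral_mul_parityKernel he (radialExtension_neg hfe p)
    (norm_eq_of_mem_sphere ξ) hz hz'

theorem isPreconnected_re_lt_zero : IsPreconnected {z : ℂ | z.re < 0} :=
  (convex_halfSpace_re_lt 0).isPreconnected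

/-- The quotient of `fourierSide` by the moment does not depend on the auxiliary exponent: on `-1 <
Re z < 0` it is the transform for either choice, and the identity theorem carries this over to `Re z
< 0`. The products avoid division by a moment that may vanish. -/
theorem fourierSide_mul_radialMoment (he : e < 2) (hf : SmoothOnSphere n f)
    (hfe : ∀ η, f (-η) = (-1) ^ e * f η) (p q : ℂ) {z : ℂ} (hz : z.re < 0) (ξ : UnitSphere n) :
    fourierSide e (hf.schwartz p) ξ z * radialMoment n q z =
      fourierSide e (hf.schwartz q) ξ z * radialMoment n p z := by
  have hopen : IsOpen {z : ℂ | z.re < 0} := isOpen_lt Complex.continuous_re continuous_const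
  have hξ : (ξ : EuclideanSpace ℝ (Fin (n + 1))) ≠ 0 := ne_zero_of_mem_unit_sphere ξ
  have hd : ∀ p q : ℂ, AnalyticOnNhd ℂ (fun z => fourierSide e (hf.schwartz p) ξ z *
      radialMoment n q z) {z : ℂ | z.re < 0} := fun p q =>
    DifferentiableOn.analyticOnNhd (fun w hw => ((differentiableAt_fourierSide e _ hξ hw).mul
      (differentiable_radialMoment n q w)).differentiableWithinAt) hopen
  refine (hd p q).eqOn_of_preconnected_of_eventuallyEq (hd q p) isPreconnected_re_lt_zero
    (z₀ := -(1 / 2)) (by simp) ?_ hz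
  have h1 : {z : ℂ | -1 < z.re} ∩ {z : ℂ | z.re < 0} ∈ 𝓝 (-(1 / 2) : ℂ) :=
    (isOpen_re_gt_neg_one.inter hopen).mem_nhds ⟨by simp; norm_num, by simp⟩
  filter_upwards [h1] with w hw
  rw [← radialMoment_mul_sphereIntegral he hf hfe p hw.1 hw.2,
    ← radialMoment_mul_sphereIntegral he hf hfe q hw.1 hw.2]
  ring

open Classical in
/-- The entire continuation of the integral transform. -/
noncomputable def SmoothOnSphere.transformExt (hf : SmoothOnSphere n f) (e : ℕ) (ξ : UnitSphere n)
    (z : ℂ) : ℂ :=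
  if -1 < z.re then sphereIntegral n (parityKernel e) f z ξ
  else fourierSide e (hf.schwartz (-z - n)) ξ z / radialMoment n (-z - n) z

theorem radialMoment_mul_transformExt (he : e < 2) (hf : SmoothOnSphere n f)
    (hfe : ∀ η, f (-η) = (-1) ^ e * f η) (p : ℂ) {z : ℂ} (hz' : z.re < 0) (ξ : UnitSphere n) :
    radialMoment n p z * hf.transformExt e ξ z = fourierSide e (hf.schwartz p) ξ z := by
  rw [SmoothOnSphere.transformExt]
  split_ifs with h
  · exact radialMoment_mul_sphereIntegral he hf hfe p h hz' ξ
  · rw [mul_div_assoc', div_eq_iff (radialMoment_ne_zero n z), mul_comm]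
    exact (fourierSide_mul_radialMoment he hf hfe p _ hz' ξ).symm

theorem isContinuation_transformExt (he : e < 2) (hf : SmoothOnSphere n f)
    (hfe : ∀ η, f (-η) = (-1) ^ e * f η) (ξ : UnitSphere n) :
    IsContinuation univ (fun z => sphereIntegral n (parityKernel e) f z ξ) (hf.transformExt e ξ) := by
  have hgt : ∀ z : ℂ, -1 < z.re → hf.transformExt e ξ z = sphereIntegral n (parityKernel e) f z ξ :=
    fun z hz => by rw [SmoothOnSphere.transformExt, if_pos hz]
  refine ⟨fun z _ => DifferentiableAt.differentiableWithinAt ?_, hgt⟩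
  rcases lt_or_ge (-1) z.re with hz | hz
  · have h1 := (differentiableOn_sphereIntegral e hf.continuous ξ).differentiableAt
      (isOpen_re_gt_neg_one.mem_nhds hz)
    refine h1.congr_of_eventuallyEq ?_
    filter_upwards [isOpen_re_gt_neg_one.mem_nhds hz] with w hw using hgt w hw
  · have hz0 : z.re < 0 := by linarith
    have hM := radialMoment_ne_zero n z
    -- The exponent is frozen at its value for `z`, since holomorphy in `w` is known only for a
    -- fixed extension; near `z` its moment stays nonzero and the quotient is still the transform.
    have h1 : DifferentiableAt ℂ (fun w => fourierSide e (hf.schwartz (-z - n)) ξ w /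
        radialMoment n (-z - n) w) z :=
      (differentiableAt_fourierSide e _ (ne_zero_of_mem_unit_sphere ξ) hz0).div
        (differentiable_radialMoment n _ z) hM
    refine h1.congr_of_eventuallyEq ?_
    filter_upwards [(isOpen_lt Complex.continuous_re continuous_const).mem_nhds hz0,
      (differentiable_radialMoment n (-z - n)).continuous.continuousAt.eventually_ne hM] with w hw hMw
    rw [eq_div_iff hMw, mul_comm]
    exact radialMoment_mul_transformExt he hf hfe _ hw ξ

theorem IsContinuation.eqOn {U : Set ℂ} (hU : IsOpen U) (hc : IsPreconnected U)
    (hsub : {z : ℂ | -1 < z.re} ⊆ U) {g G H : ℂ → ℂ} (hG : IsContinuation U g G)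
    (hH : IsContinuation U g H) : EqOn G H U := by
  refine (hG.1.analyticOnNhd hU).eqOn_of_preconnected_of_eventuallyEq (hH.1.analyticOnNhd hU) hc
    (z₀ := 0) (hsub (by simp)) ?_
  filter_upwards [isOpen_re_gt_neg_one.mem_nhds (by simp : (0 : ℂ) ∈ {z : ℂ | -1 < z.re})] with w hw
  rw [hG.2 w hw, hH.2 w hw]

theorem isContinuation_continuation {U : Set ℂ} {g G : ℂ → ℂ} (hG : IsContinuation U g G) :
    IsContinuation U g (continuation U g) := by
  have h : ∃ G : ℂ → ℂ, IsContinuation U g G := ⟨G, hG⟩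
  rw [continuation, dif_pos h]
  exact h.choose_spec

/-- The transform with the kernel `|t|^z (sign t)^e / Γ((z+1+e)/2)`. -/
noncomputable def parityJ (n e : ℕ) (z : ℂ) (f : UnitSphere n → ℂ) : UnitSphere n → ℂ :=
  sphereTransform n (parityKernel e) univ z f

theorem transformDefined_parityKernel (he : e < 2) (hf : SmoothOnSphere n f)
    (hfe : ∀ η, f (-η) = (-1) ^ e * f η) : TransformDefined n (parityKernel e) univ f :=
  fun ξ => ⟨fun _ hz => integrable_sphereIntegrand_parityKernel e hf.continuous hz ξ,
    isContinuation_continuation (isContinuation_transformExt he hf hfe ξ)⟩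

theorem parityJ_eq_transformExt (he : e < 2) (hf : SmoothOnSphere n f)
    (hfe : ∀ η, f (-η) = (-1) ^ e * f η) (z : ℂ) (ξ : UnitSphere n) :
    parityJ n e z f ξ = hf.transformExt e ξ z :=
  ((transformDefined_parityKernel he hf hfe ξ).2.eqOn isOpen_univ isPreconnected_univ
    (subset_univ _) (isContinuation_transformExt he hf hfe ξ)) (mem_univ z)

theorem differentiable_parityJ (he : e < 2) (hf : SmoothOnSphere n f)
    (hfe : ∀ η, f (-η) = (-1) ^ e * f η) (ξ : UnitSphere n) :
    Differentiable ℂ (fun z => parityJ n e z f ξ) := by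
  rw [← differentiableOn_univ]
  exact (transformDefined_parityKernel he hf hfe ξ).2.1

theorem parityJ_eq_sphereIntegral (he : e < 2) (hf : SmoothOnSphere n f)
    (hfe : ∀ η, f (-η) = (-1) ^ e * f η) {z : ℂ} (hz : -1 < z.re) (ξ : UnitSphere n) :
    parityJ n e z f ξ = sphereIntegral n (parityKernel e) f z ξ :=
  (transformDefined_parityKernel he hf hfe ξ).2.2 z hz

theorem radialMoment_mul_parityJ (he : e < 2) (hf : SmoothOnSphere n f)
    (hfe : ∀ η, f (-η) = (-1) ^ e * f η) (p : ℂ) {z : ℂ} (hz' : z.re < 0) (ξ : UnitSphere n) :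
    radialMoment n p z * parityJ n e z f ξ = fourierSide e (hf.schwartz p) ξ z := by
  rw [parityJ_eq_transformExt he hf hfe, radialMoment_mul_transformExt he hf hfe p hz']

theorem eq_of_differentiable_of_eqOn_re_gt {g h : ℂ → ℂ} (hg : Differentiable ℂ g)
    (hh : Differentiable ℂ h) (H : ∀ z : ℂ, -1 < z.re → g z = h z) : g = h := by
  funext z
  exact IsContinuation.eqOn isOpen_univ isPreconnected_univ (subset_univ _)
    (g := h) ⟨hg.differentiableOn, H⟩ ⟨hh.differentiableOn, fun _ _ => rfl⟩ (mem_univ z)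

theorem sphereIntegral_parityKernel_neg (n e : ℕ) (f : UnitSphere n → ℂ) (z : ℂ) (ξ : UnitSphere n) :
    sphereIntegral n (parityKernel e) f z (-ξ) =
      (-1) ^ e * sphereIntegral n (parityKernel e) f z ξ := by
  rw [sphereIntegral, sphereIntegral, ← integral_const_mul]
  refine integral_congr_ae (Eventually.of_forall fun η => ?_)
  simp only [sphereIntegrand, coe_neg_sphere, inner_neg_left, parityKernel_neg]
  ring

theorem parityJ_neg (he : e < 2) (hf : SmoothOnSphere n f)
    (hfe : ∀ η, f (-η) = (-1) ^ e * f η) (z : ℂ) (ξ : UnitSphere n) :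
    parityJ n e z f (-ξ) = (-1) ^ e * parityJ n e z f ξ := by
  refine congrFun (eq_of_differentiable_of_eqOn_re_gt (g := fun z => parityJ n e z f (-ξ))
    (h := fun z => (-1) ^ e * parityJ n e z f ξ) (differentiable_parityJ he hf hfe _)
    ((differentiable_parityJ he hf hfe ξ).const_mul _) fun z hz => ?_) z
  simp only [parityJ_eq_sphereIntegral he hf hfe hz, sphereIntegral_parityKernel_neg]

/-! ### Smoothness of the transform. -/

theorem integrableOn_rpow_mul_inv_one_add_sq_pow {a c : ℝ} (ha : -1 < a) (hc : 0 < c) {k : ℕ}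
    (hk : a + 1 < k) : IntegrableOn (fun s : ℝ => s ^ a * ((1 + (c * s) ^ 2) ^ k)⁻¹) (Ioi 0) := by
  have hcont : Continuous (fun s : ℝ => ((((1 + (c * s) ^ 2) ^ k)⁻¹ : ℝ) : ℂ)) := by
    refine Complex.continuous_ofReal.comp (Continuous.inv₀ (by fun_prop) fun s => ?_)
    positivity
  have h : MellinConvergent (fun s : ℝ => ((((1 + (c * s) ^ 2) ^ k)⁻¹ : ℝ) : ℂ)) ((a + 1 : ℝ) : ℂ) := by
    refine mellinConvergent_of_isBigO_rpow (a := k) (b := 0)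
      (hcont.locallyIntegrable.locallyIntegrableOn _) ?_ (by simpa using hk) ?_
      (by simp only [Complex.ofReal_re]; linarith)
    · refine Asymptotics.IsBigO.of_bound (c ^ k)⁻¹ ?_
      filter_upwards [eventually_gt_atTop 0] with s hs
      rw [Complex.norm_real, Real.norm_of_nonneg (by positivity), Real.norm_of_nonneg (by positivity),
        Real.rpow_neg hs.le, Real.rpow_natCast, ← mul_inv, ← mul_pow]
      refine inv_anti₀ (by positivity) (pow_le_pow_left₀ (by positivity) ?_ k)
      nlinarith [sq_nonneg (c * s - 1 / 2)]
    · simp only [neg_zero, Real.rpow_zero]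
      exact (hcont.tendsto 0).isBigO_one ℝ |>.mono nhdsWithin_le_nhds
  refine (h.norm).congr ?_
  filter_upwards [ae_restrict_mem measurableSet_Ioi] with s hs
  have hs : 0 < s := hs
  rw [norm_smul, Complex.norm_cpow_eq_rpow_re_of_pos hs, Complex.norm_real,
    Real.norm_of_nonneg (by positivity)]
  simp

/-- Differentiation of `H (s • y)` in `y` produces a factor `s`, which raises the Mellin exponent by
one. On the ball of radius `‖y‖ / 2` the points stay away from the origin, so a single decaying
bound serves for all of them. -/
theorem SchwartzMap.hasFDerivAt_mellin_ray {E F : Type} [NormedAddCommGroup E] [NormedSpace ℝ E]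
    [NormedAddCommGroup F] [NormedSpace ℂ F]
    (H : SchwartzMap E F) {w : ℂ} (hw : 0 < w.re) {y : E} (hy : y ≠ 0) :
    HasFDerivAt (fun y => mellin (fun s : ℝ => H (s • y)) w)
      (mellin (fun s : ℝ => SchwartzMap.fderivCLM ℝ E F H (s • y)) (w + 1)) y := by
  set D := SchwartzMap.fderivCLM ℝ E F H
  obtain ⟨k, hk⟩ := exists_nat_gt (w.re + 1)
  obtain ⟨C, hC0, hC⟩ := D.exists_norm_le_inv_one_add_sq_pow k
  have hy0 : 0 < ‖y‖ := norm_pos_iff.2 hy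
  have hcp : ∀ v : ℂ, AEStronglyMeasurable (fun s : ℝ => (s : ℂ) ^ v) (volume.restrict (Ioi 0)) :=
    fun v => Measurable.aestronglyMeasurable (by fun_prop)
  refine hasFDerivAt_integral_of_dominated_of_fderiv_le (𝕜 := ℝ)
    (bound := fun s => C * (s ^ w.re * ((1 + (‖y‖ / 2 * s) ^ 2) ^ k)⁻¹))
    (F' := fun y s => (s : ℂ) ^ (w + 1 - 1) • D (s • y))
    (ball_mem_nhds y (half_pos hy0)) ?_ ?_ ?_ ?_ ?_ ?_
  · refine Eventually.of_forall fun x => (hcp _).smul ?_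
    exact (H.continuous.comp (by fun_prop)).aestronglyMeasurable
  · exact H.mellinConvergent_ray hy hw
  · exact (hcp _).smul (D.continuous.comp (by fun_prop)).aestronglyMeasurable
  · filter_upwards [ae_restrict_mem measurableSet_Ioi] with s hs x hx
    have hs : 0 < s := hs
    have hx : ‖y‖ / 2 ≤ ‖x‖ := by
      rw [mem_ball, dist_eq_norm] at hx
      have := norm_sub_norm_le y x
      rw [norm_sub_rev] at this
      linarith
    rw [norm_smul, Complex.norm_cpow_eq_rpow_re_of_pos hs, add_sub_cancel_right, mul_left_comm]
    refine mul_le_mul_of_nonneg_left ((hC _).trans ?_) (by positivity)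
    refine mul_le_mul_of_nonneg_left (inv_anti₀ (by positivity) ?_) hC0
    rw [norm_smul, Real.norm_of_nonneg hs.le, mul_comm s]
    gcongr
  · exact (integrableOn_rpow_mul_inv_one_add_sq_pow (by linarith) (half_pos hy0) hk).const_mul C
  · filter_upwards [ae_restrict_mem measurableSet_Ioi] with s hs x hx
    have hs : 0 < s := hs
    have hs' : (s : ℂ) ≠ 0 := by exact_mod_cast hs.ne'
    have h1 : HasFDerivAt H (D (s • x)) (s • x) := H.differentiableAt.hasFDerivAt
    have h2 : HasFDerivAt (fun x : E => s • x) (s • ContinuousLinearMap.id ℝ E) x :=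
      (hasFDerivAt_id x).const_smul s
    have h3 := (h1.comp x h2).const_smul ((s : ℂ) ^ (w - 1))
    refine h3.congr_fderiv ?_
    ext v
    have : (s : ℂ) ^ (w + 1 - 1) = (s : ℂ) ^ (w - 1) * s := by
      rw [add_sub_cancel_right]
      conv_lhs => rw [← sub_add_cancel w 1, Complex.cpow_add _ _ hs', Complex.cpow_one]
    rw [this]
    simp [mul_smul]

/-- The derivative is an integral of the same kind for the Schwartz function `fderiv H` at the
exponent `w + 1`. The induction therefore varies the target space and the exponent. -/
theorem SchwartzMap.contDiffOn_mellin_ray {E F : Type} [NormedAddCommGroup E] [NormedSpace ℝ E]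
    [NormedAddCommGroup F] [NormedSpace ℂ F]
    (H : SchwartzMap E F) {w : ℂ} (hw : 0 < w.re) :
    ContDiffOn ℝ ∞ (fun y => mellin (fun s : ℝ => H (s • y)) w) {0}ᶜ := by
  rw [contDiffOn_infty]
  intro k
  induction k generalizing F w with
  | zero =>
    exact contDiffOn_zero.2 fun y hy => (H.hasFDerivAt_mellin_ray hw hy).continuousAt.continuousWithinAt
  | succ k ih =>
    push_cast
    rw [contDiffOn_succ_iff_fderiv_of_isOpen isOpen_compl_singleton]
    refine ⟨fun y hy => (H.hasFDerivAt_mellin_ray hw hy).differentiableAt.differentiableWithinAt,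
      by simp, ?_⟩
    refine (ih (SchwartzMap.fderivCLM ℝ E F H) (w := w + 1) (by simp; linarith)).congr fun y hy => ?_
    exact (H.hasFDerivAt_mellin_ray hw hy).fderiv

theorem smoothOnSphere_parityJ_of_re_lt_zero (he : e < 2) (hf : SmoothOnSphere n f)
    (hfe : ∀ η, f (-η) = (-1) ^ e * f η) {z : ℂ} (hz : z.re < 0) :
    SmoothOnSphere n (parityJ n e z f) := by
  refine smoothOnSphere_of_contDiffAt fun ξ => ⟨fun y => fourierFactor e z *
    mellin (fun s : ℝ => 𝓕 (hf.schwartz (-z - n)) (s • y)) (-z) / radialMoment n (-z - n) z, ?_, ?_⟩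
  · have h := ((𝓕 (hf.schwartz (-z - n))).contDiffOn_mellin_ray (w := -z)
      (by simpa using hz)).contDiffAt
      (isOpen_compl_singleton.mem_nhds (ne_zero_of_mem_unit_sphere ξ))
    exact (contDiffAt_const.mul h).div_const _
  · refine Eventually.of_forall fun η => ?_
    rw [eq_div_iff (radialMoment_ne_zero n z), mul_comm]
    exact radialMoment_mul_parityJ he hf hfe _ hz η

theorem reflection_span_singleton_apply (u t : EuclideanSpace ℝ (Fin (n + 1))) :
    (ℝ ∙ u).reflection t = (2 * ⟪u, t⟫_ℝ / ‖u‖ ^ 2) • u - t := by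
  rw [Submodule.reflection_singleton_apply, ← Nat.cast_smul_eq_nsmul ℝ, smul_smul]
  simp only [Nat.cast_ofNat, mul_div_assoc, RCLike.ofReal_real_eq_id, id_eq]

/-- For unit vectors, an integral against a kernel in `⟪y, x⟫` is one against a fixed kernel. -/
theorem integral_mul_comp_inner_eq_integral_reflection {ξ y : EuclideanSpace ℝ (Fin (n + 1))}
    (hξ : ‖ξ‖ = 1) (hy : ‖y‖ = 1) (hne : y + ξ ≠ 0) (K : ℝ → ℂ)
    (G : EuclideanSpace ℝ (Fin (n + 1)) → ℂ) :
    ∫ x, K ⟪y, x⟫_ℝ * G x =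
      ∫ t, K ⟪ξ, t⟫_ℝ * G ((2 * ⟪y + ξ, t⟫_ℝ / ‖y + ξ‖ ^ 2) • (y + ξ) - t) := by
  have hu : ‖y + ξ‖ ^ 2 ≠ 0 := pow_ne_zero 2 (norm_ne_zero_iff.2 hne)
  rw [← ((ℝ ∙ (y + ξ)).reflection).measurePreserving.integral_comp
    ((ℝ ∙ (y + ξ)).reflection).toHomeomorph.measurableEmbedding]
  refine integral_congr_ae (Eventually.of_forall fun t => ?_)
  have h1 := reflection_span_singleton_apply (y + ξ) t
  -- The reflection fixing the line through `y + ξ` exchanges the two unit vectors.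
  have h2 : ⟪y, (ℝ ∙ (y + ξ)).reflection t⟫_ℝ = ⟪ξ, t⟫_ℝ := by
    have h3 : ‖y + ξ‖ ^ 2 = 2 * ⟪y, y + ξ⟫_ℝ := by
      rw [norm_add_sq_real, inner_add_right, real_inner_self_eq_norm_sq, hξ, hy]; ring
    have h4 : ⟪y, y + ξ⟫_ℝ ≠ 0 := by
      intro h; rw [h3, h] at hu; simp at hu
    rw [h1, inner_sub_right, inner_smul_right, h3, inner_add_left]
    field_simp
    ring
  simp only
  rw [h2, h1]

/-- The kernel `k` is only locally integrable, but `y` now enters through the smooth factor alone.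
Reflections preserve the norm, so the support in `t` stays in one ball for all `y`, and smoothness
of convolutions with a parameter applies. -/
theorem contDiffOn_integral_comp_reflection {ξ : EuclideanSpace ℝ (Fin (n + 1))}
    {k : EuclideanSpace ℝ (Fin (n + 1)) → ℂ} (hk : LocallyIntegrable k)
    {G : EuclideanSpace ℝ (Fin (n + 1)) → ℂ} (hG : ContDiff ℝ ∞ G) {R : ℝ}
    (hR : ∀ x, R ≤ ‖x‖ → G x = 0) :
    ContDiffOn ℝ ∞ (fun y => ∫ t, k t * G ((2 * ⟪y + ξ, t⟫_ℝ / ‖y + ξ‖ ^ 2) • (y + ξ) - t))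
      {y | y + ξ ≠ 0} := by
  -- The sign of `t` is reversed because the integral is read as a convolution at the point `0`,
  -- where `g y` is evaluated at `0 - t`.
  set g : EuclideanSpace ℝ (Fin (n + 1)) → EuclideanSpace ℝ (Fin (n + 1)) → ℂ := fun y t =>
    G ((2 * ⟪y + ξ, -t⟫_ℝ / ‖y + ξ‖ ^ 2) • (y + ξ) - (-t))
  have hs : IsOpen {y : EuclideanSpace ℝ (Fin (n + 1)) | y + ξ ≠ 0} :=
    isOpen_ne_fun (by fun_prop) continuous_const
  have h := contDiffOn_convolution_right_with_param (μ := volume) (n := ⊤)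
    (ContinuousLinearMap.mul ℝ ℂ) (g := g) hs
    (isCompact_closedBall (0 : EuclideanSpace ℝ (Fin (n + 1))) R) ?_ hk ?_
  · have h2 : ContDiffOn ℝ ∞ (fun y : EuclideanSpace ℝ (Fin (n + 1)) =>
        (y, (0 : EuclideanSpace ℝ (Fin (n + 1))))) {y | y + ξ ≠ 0} := by fun_prop
    refine (h.comp h2 fun y hy => ⟨hy, mem_univ _⟩).congr fun y hy => ?_
    simp only [Function.comp_apply, convolution, ContinuousLinearMap.mul_apply', zero_sub, g, neg_neg]
  · intro y t hy ht
    rw [mem_closedBall_zero_iff, not_le] at ht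
    refine hR _ (ht.le.trans (le_of_eq ?_))
    rw [← reflection_span_singleton_apply, LinearIsometryEquiv.norm_map, norm_neg]
  · refine hG.comp_contDiffOn ?_
    have h1 : ContDiffOn ℝ ∞ (fun q : EuclideanSpace ℝ (Fin (n + 1)) × EuclideanSpace ℝ (Fin (n + 1)) =>
        2 * ⟪q.1 + ξ, -q.2⟫_ℝ / ‖q.1 + ξ‖ ^ 2) ({y | y + ξ ≠ 0} ×ˢ univ) := by
      refine ContDiffOn.div ?_ ?_ fun q hq => pow_ne_zero 2 (norm_ne_zero_iff.2 hq.1)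
      · exact (contDiff_const.mul (ContDiff.inner ℝ (by fun_prop) (by fun_prop))).contDiffOn
      · exact (ContDiff.norm_sq ℝ (by fun_prop)).contDiffOn
    exact (h1.smul (by fun_prop)).sub (by fun_prop)

theorem smoothOnSphere_parityJ_of_neg_one_lt_re (he : e < 2) (hf : SmoothOnSphere n f)
    (hfe : ∀ η, f (-η) = (-1) ^ e * f η) {z : ℂ} (hz : -1 < z.re) :
    SmoothOnSphere n (parityJ n e z f) := by
  refine smoothOnSphere_of_contDiffAt fun ξ => ⟨fun y =>
    (∫ t, parityKernel e z ⟪(ξ : EuclideanSpace ℝ (Fin (n + 1))), t⟫_ℝ *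
      radialExtension n (-z - n) f ((2 * ⟪y + ξ, t⟫_ℝ / ‖y + ξ‖ ^ 2) • (y + ξ) - t)) /
        radialMoment n (-z - n) z, ?_, ?_⟩
  · refine ContDiffAt.div_const ?_ _
    have hk : LocallyIntegrable (fun x : EuclideanSpace ℝ (Fin (n + 1)) =>
        parityKernel e z ⟪(ξ : EuclideanSpace ℝ (Fin (n + 1))), x⟫_ℝ) := by
      have := (locallyIntegrable_rawKernel_inner n e hz (norm_eq_of_mem_sphere ξ)).smul
        (Complex.Gamma ((z + 1 + e) / 2))⁻¹
      refine this.congr (Eventually.of_forall fun x => ?_)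
      simp only [Pi.smul_apply, smul_eq_mul, parityKernel]
      ring
    refine (contDiffOn_integral_comp_reflection hk (hf.contDiff_radialExtension _) (R := 3 / 2)
      fun x hx => radialExtension_eq_zero _ _ (Or.inr hx)).contDiffAt ?_
    refine (isOpen_ne_fun (by fun_prop) continuous_const).mem_nhds ?_
    have : (ξ : EuclideanSpace ℝ (Fin (n + 1))) ≠ 0 := ne_zero_of_mem_unit_sphere ξ
    simpa [← two_smul ℝ] using this
  · have h1 : ∀ᶠ η : UnitSphere n in 𝓝 ξ, (η : EuclideanSpace ℝ (Fin (n + 1))) + ξ ≠ 0 := by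
      refine ContinuousAt.eventually_ne (by fun_prop) ?_
      have : (ξ : EuclideanSpace ℝ (Fin (n + 1))) ≠ 0 := ne_zero_of_mem_unit_sphere ξ
      simpa [← two_smul ℝ] using this
    filter_upwards [h1] with η hη
    rw [eq_div_iff (radialMoment_ne_zero n z), mul_comm, parityJ_eq_sphereIntegral he hf hfe hz,
      ← integral_radialExtension_mul_parityKernel,
      ← integral_mul_comp_inner_eq_integral_reflection (norm_eq_of_mem_sphere ξ)
        (norm_eq_of_mem_sphere η) hη]
    simp only [mul_comm]

theorem smoothOnSphere_parityJ (he : e < 2) (hf : SmoothOnSphere n f)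
    (hfe : ∀ η, f (-η) = (-1) ^ e * f η) (z : ℂ) : SmoothOnSphere n (parityJ n e z f) := by
  rcases lt_or_ge z.re 0 with hz | hz
  · exact smoothOnSphere_parityJ_of_re_lt_zero he hf hfe hz
  · exact smoothOnSphere_parityJ_of_neg_one_lt_re he hf hfe (by linarith)

/-! ### Locally uniform bounds and symmetry of the transform. -/

theorem ContinuousAt.exists_nhds_norm_le {g : ℂ → ℂ} {z : ℂ} (hg : ContinuousAt g z) :
    ∃ C, 0 ≤ C ∧ ∀ᶠ w in 𝓝 z, ‖g w‖ ≤ C :=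
  ⟨‖g z‖ + 1, by positivity,
    (hg.norm.eventually_lt continuousAt_const (lt_add_one _)).mono fun _ h => h.le⟩

theorem exists_bound_sphereIntegral (e : ℕ) (hf : Continuous f) {z : ℂ} (hz : -1 < z.re) :
    ∃ C, ∀ᶠ w in 𝓝 z, ∀ ξ, ‖sphereIntegral n (parityKernel e) f w ξ‖ ≤ C := by
  obtain ⟨C, hC0, hC⟩ := exists_norm_le_of_continuous hf
  obtain ⟨a, ha, haz⟩ := exists_between hz
  obtain ⟨D, hD⟩ := exists_bound_integral_abs_inner_rpow n ha
  obtain ⟨A, hA0, hA⟩ := ((differentiable_inv_Gamma_parity e).continuous.continuousAt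
    (x := z)).exists_nhds_norm_le
  refine ⟨C * D * A, ?_⟩
  filter_upwards [hA, Complex.continuous_re.continuousAt.preimage_mem_nhds (Ici_mem_nhds haz)]
    with w hw hwa ξ
  rw [sphereIntegral_parityKernel, norm_mul]
  have h1 : ‖∫ η : UnitSphere n, f η * rawKernel e w ⟪(ξ : EuclideanSpace ℝ (Fin (n + 1))),
        (η : EuclideanSpace ℝ (Fin (n + 1)))⟫_ℝ ∂(surfaceMeasure n)‖ ≤ C * D := by
    refine (norm_integral_le_of_norm_le ((hD ξ).1.const_mul C) ?_).trans ?_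
    · filter_upwards [ae_norm_mul_rawKernel_le e hC (a := a) ξ] with η hη using hη w hwa
    · rw [integral_const_mul]
      exact mul_le_mul_of_nonneg_left (hD ξ).2 hC0
  exact mul_le_mul h1 hw (norm_nonneg _) ((norm_nonneg _).trans h1)

theorem SchwartzMap.exists_bound_mellin_ray {E F : Type*} [NormedAddCommGroup E] [NormedSpace ℝ E]
    [NormedAddCommGroup F] [NormedSpace ℂ F] (H : SchwartzMap E F) {a b : ℝ} (ha : 0 < a)
    (hab : a ≤ b) : ∃ C, ∀ w : ℂ, a ≤ w.re → w.re ≤ b → ∀ ξ : E, ‖ξ‖ = 1 →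
      ‖mellin (fun s : ℝ => H (s • ξ)) w‖ ≤ C := by
  obtain ⟨k, hk⟩ := exists_nat_gt b
  obtain ⟨C, hC0, hC⟩ := H.exists_norm_le_inv_one_add_sq_pow k
  have h1 := integrableOn_rpow_mul_inv_one_add_sq_pow (a := a - 1) (c := 1) (k := k) (by linarith)
    one_pos (by linarith)
  have h2 := integrableOn_rpow_mul_inv_one_add_sq_pow (a := b - 1) (c := 1) (k := k) (by linarith)
    one_pos (by linarith)
  refine ⟨_, fun w hw hw' ξ hξ => norm_integral_le_of_norm_le ((h1.add h2).const_mul C) ?_⟩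
  filter_upwards [ae_restrict_mem measurableSet_Ioi] with s hs
  have hs : 0 < s := hs
  have hH := hC (s • ξ)
  rw [norm_smul, hξ, mul_one, Real.norm_of_nonneg hs.le] at hH
  -- The two extreme exponents dominate all intermediate ones: the lower for `s ≤ 1`, the upper for
  -- `s ≥ 1`.
  have hp : s ^ (w.re - 1) ≤ s ^ (a - 1) + s ^ (b - 1) := by
    rcases le_total s 1 with h | h
    · have := Real.rpow_le_rpow_of_exponent_ge hs h (by linarith : a - 1 ≤ w.re - 1)
      have := Real.rpow_nonneg hs.le (b - 1)
      linarith
    · have := Real.rpow_le_rpow_of_exponent_le h (by linarith : w.re - 1 ≤ b - 1)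
      have := Real.rpow_nonneg hs.le (a - 1)
      linarith
  rw [norm_smul, Complex.norm_cpow_eq_rpow_re_of_pos hs, Complex.sub_re, Complex.one_re]
  refine (mul_le_mul hp hH (norm_nonneg _) (by positivity)).trans (le_of_eq ?_)
  simp only [Pi.add_apply, one_mul]
  ring

/-- Uniformity in `ξ` is what makes pairings of transforms over the sphere holomorphic in the
parameter. -/
theorem exists_bound_parityJ (he : e < 2) (hf : SmoothOnSphere n f)
    (hfe : ∀ η, f (-η) = (-1) ^ e * f η) (z : ℂ) :
    ∃ C, ∀ᶠ w in 𝓝 z, ∀ ξ, ‖parityJ n e w f ξ‖ ≤ C := by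
  rcases lt_or_ge (-1) z.re with hz | hz
  · obtain ⟨C, hC⟩ := exists_bound_sphereIntegral e hf.continuous hz
    refine ⟨C, ?_⟩
    filter_upwards [hC, isOpen_re_gt_neg_one.mem_nhds hz] with w hw hw' ξ
    rw [parityJ_eq_sphereIntegral he hf hfe hw']
    exact hw ξ
  · have hM := radialMoment_ne_zero n z
    have hMd := (differentiable_radialMoment n (-z - n)).continuous
    obtain ⟨A, hA0, hA⟩ := ((differentiable_fourierFactor e).continuous.continuousAt
      (x := z)).exists_nhds_norm_le
    obtain ⟨B, hB0, hB⟩ := (hMd.continuousAt.inv₀ hM).exists_nhds_norm_le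
    -- Here `Re z ≤ -1`, so for `w` near `z` the Mellin exponent `-w` has real part between `1/2`
    -- and `-Re z + 1`.
    obtain ⟨D, hD⟩ := (𝓕 (hf.schwartz (-z - n))).exists_bound_mellin_ray
      (a := 1 / 2) (b := -z.re + 1) (by norm_num) (by linarith)
    refine ⟨A * D * B, ?_⟩
    have h1 : ∀ᶠ w : ℂ in 𝓝 z, w.re ∈ Ioo (z.re - 1) (z.re + 1 / 2) :=
      Complex.continuous_re.continuousAt.preimage_mem_nhds
        (Ioo_mem_nhds (by linarith) (by linarith))
    filter_upwards [hA, hB, h1, hMd.continuousAt.eventually_ne hM] with w hwA hwB hw hMw ξ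
    have h2 : parityJ n e w f ξ = fourierSide e (hf.schwartz (-z - n)) ξ w *
        (radialMoment n (-z - n) w)⁻¹ := by
      rw [← radialMoment_mul_parityJ he hf hfe _ (by linarith [hw.2])]
      field_simp
    have h3 := hD (-w) (by simp; linarith [hw.2]) (by simp; linarith [hw.1]) ξ
      (norm_eq_of_mem_sphere ξ)
    have h4 : ‖fourierSide e (hf.schwartz (-z - n)) ξ w‖ ≤ A * D := by
      rw [fourierSide, norm_mul]
      exact mul_le_mul hwA h3 (norm_nonneg _) hA0
    rw [h2, norm_mul]
    exact mul_le_mul h4 hwB (norm_nonneg _) ((norm_nonneg _).trans h4)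

theorem differentiable_integral_sphere {P : ℂ → UnitSphere n → ℂ}
    (hP : ∀ z, Continuous (P z)) (hd : ∀ ξ, Differentiable ℂ fun z => P z ξ)
    (hb : ∀ z, ∃ C, ∀ᶠ w in 𝓝 z, ∀ ξ, ‖P w ξ‖ ≤ C) :
    Differentiable ℂ fun z => ∫ ξ, P z ξ ∂(surfaceMeasure n) := by
  rw [← differentiableOn_univ]
  refine differentiableOn_integral_of_locally_dominated isOpen_univ
    (fun z _ => (hP z).measurable.aestronglyMeasurable)
    (Eventually.of_forall fun ξ => (hd ξ).differentiableOn) fun z _ => ?_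
  obtain ⟨C, hC⟩ := hb z
  exact ⟨fun _ => C, integrable_const C, _, hC, Eventually.of_forall fun ξ w hw => hw ξ⟩

/-- The transform is symmetric for the bilinear pairing of functions on the sphere. -/
theorem integral_parityJ_mul_eq (he : e < 2) (hf : SmoothOnSphere n f)
    (hfe : ∀ η, f (-η) = (-1) ^ e * f η) {g : UnitSphere n → ℂ} (hg : SmoothOnSphere n g)
    (hge : ∀ η, g (-η) = (-1) ^ e * g η) (z : ℂ) :
    ∫ ξ, parityJ n e z f ξ * g ξ ∂(surfaceMeasure n) =
      ∫ ξ, f ξ * parityJ n e z g ξ ∂(surfaceMeasure n) := by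
  have hentire : ∀ {f g : UnitSphere n → ℂ}, SmoothOnSphere n f →
      (∀ η, f (-η) = (-1) ^ e * f η) → SmoothOnSphere n g →
      Differentiable ℂ fun z => ∫ ξ, g ξ * parityJ n e z f ξ ∂(surfaceMeasure n) := by
    intro f g hf hfe hg
    obtain ⟨B, hB0, hB⟩ := exists_norm_le_of_continuous hg.continuous
    refine differentiable_integral_sphere
      (fun z => hg.continuous.mul (smoothOnSphere_parityJ he hf hfe z).continuous)
      (fun ξ => (differentiable_parityJ he hf hfe ξ).const_mul _) fun z => ?_
    obtain ⟨C, hC⟩ := exists_bound_parityJ he hf hfe z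
    refine ⟨B * C, hC.mono fun w hw ξ => ?_⟩
    rw [norm_mul]
    exact mul_le_mul (hB ξ) (hw ξ) (norm_nonneg _) hB0
  -- Both sides are entire in `z`, so it suffices to treat `Re z > -1`, where the claim is Fubini
  -- and the symmetry of the inner product.
  refine congrFun (eq_of_differentiable_of_eqOn_re_gt
    (g := fun z => ∫ ξ, parityJ n e z f ξ * g ξ ∂(surfaceMeasure n))
    (h := fun z => ∫ ξ, f ξ * parityJ n e z g ξ ∂(surfaceMeasure n)) ?_ (hentire hg hge hf)
    fun z hz => ?_) z
  · simpa only [mul_comm] using hentire hf hfe hg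
  obtain ⟨A, hA0, hA⟩ := exists_norm_le_of_continuous hf.continuous
  obtain ⟨B, hB0, hB⟩ := exists_norm_le_of_continuous hg.continuous
  obtain ⟨D, hD⟩ := exists_bound_integral_abs_inner_rpow n hz
  set F : UnitSphere n → UnitSphere n → ℂ := fun ξ η => g ξ * (f η *
    rawKernel e z ⟪(ξ : EuclideanSpace ℝ (Fin (n + 1))), (η : EuclideanSpace ℝ (Fin (n + 1)))⟫_ℝ)
  have hmeas : AEStronglyMeasurable (Function.uncurry F)
      ((surfaceMeasure n).prod (surfaceMeasure n)) := by
    refine Measurable.aestronglyMeasurable ?_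
    have hk : Measurable fun p : UnitSphere n × UnitSphere n => rawKernel e z
        ⟪(p.1 : EuclideanSpace ℝ (Fin (n + 1))), (p.2 : EuclideanSpace ℝ (Fin (n + 1)))⟫_ℝ :=
      (measurable_rawKernel e z).comp (by fun_prop)
    exact (hg.continuous.measurable.comp measurable_fst).mul
      ((hf.continuous.measurable.comp measurable_snd).mul hk)
  -- The inner integral of the norm is bounded uniformly in `ξ`, and the surface measure is finite.
  have hI : Integrable (Function.uncurry F) ((surfaceMeasure n).prod (surfaceMeasure n)) := by
    rw [integrable_prod_iff hmeas]
    refine ⟨Eventually.of_forall fun ξ =>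
      (integrable_mul_rawKernel e hf.continuous hz ξ).const_mul (g ξ), ?_⟩
    refine (integrable_const (B * (A * D))).mono' hmeas.norm.integral_prod_right'
      (Eventually.of_forall fun ξ => ?_)
    rw [Real.norm_of_nonneg (integral_nonneg fun _ => norm_nonneg _)]
    simp only [Function.uncurry_apply_pair, F, norm_mul (g ξ), integral_const_mul]
    refine mul_le_mul (hB ξ) ?_ (integral_nonneg fun _ => norm_nonneg _) hB0
    calc _ ≤ ∫ η : UnitSphere n, A * |⟪(ξ : EuclideanSpace ℝ (Fin (n + 1))),
          (η : EuclideanSpace ℝ (Fin (n + 1)))⟫_ℝ| ^ z.re ∂(surfaceMeasure n) := by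
          refine integral_mono_ae (integrable_mul_rawKernel e hf.continuous hz ξ).norm
            ((hD ξ).1.const_mul A) ?_
          filter_upwards [ae_norm_mul_rawKernel_le e hA (a := z.re) ξ] with η hη using hη z le_rfl
      _ ≤ A * D := by
          rw [integral_const_mul]
          exact mul_le_mul_of_nonneg_left (hD ξ).2 hA0
  have hswap := integral_integral_swap hI
  simp only [parityJ_eq_sphereIntegral he hf hfe hz, parityJ_eq_sphereIntegral he hg hge hz,
    sphereIntegral_parityKernel]
  calc _ = (∫ ξ, ∫ η, F ξ η ∂(surfaceMeasure n) ∂(surfaceMeasure n)) *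
        (Complex.Gamma ((z + 1 + e) / 2))⁻¹ := by
        rw [← integral_mul_const]
        refine integral_congr_ae (Eventually.of_forall fun ξ => ?_)
        simp only [F, integral_const_mul]
        ring
    _ = _ := by
        rw [hswap, ← integral_mul_const]
        refine integral_congr_ae (Eventually.of_forall fun η => ?_)
        simp only [← mul_assoc]
        rw [← integral_const_mul]
        congr 1
        refine integral_congr_ae (Eventually.of_forall fun ξ => ?_)
        simp only [F, real_inner_comm (ξ : EuclideanSpace ℝ (Fin (n + 1)))
          (η : EuclideanSpace ℝ (Fin (n + 1)))]
        ring

/-! ### The inversion formula. -/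

/-- `4 π^n / (Γ((e-z)/2) Γ((z+n+1+e)/2))`. -/
noncomputable def parityConst (n e : ℕ) (z : ℂ) : ℂ :=
  4 * (Real.pi : ℂ) ^ n / (Complex.Gamma ((e - z) / 2) * Complex.Gamma ((z + n + 1 + e) / 2))

theorem differentiable_parityConst (n e : ℕ) : Differentiable ℂ (parityConst n e) := by
  have h1 : Differentiable ℂ fun z : ℂ => (Complex.Gamma ((e - z) / 2))⁻¹ :=
    Complex.differentiable_one_div_Gamma.comp (by fun_prop : Differentiable ℂ fun z : ℂ => (e - z) / 2)
  have h2 : Differentiable ℂ fun z : ℂ => (Complex.Gamma ((z + n + 1 + e) / 2))⁻¹ :=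
    Complex.differentiable_one_div_Gamma.comp
      (by fun_prop : Differentiable ℂ fun z : ℂ => (z + n + 1 + e) / 2)
  unfold parityConst
  simp only [div_eq_mul_inv _ (_ * _), mul_inv]
  exact (h1.mul h2).const_mul _

/-- The exponents of `π` add up to `n`. The sign `(-1)^e`, which comes from `𝓕𝓕G(x) = G(-x)`,
cancels `i^e i^e`. -/
theorem fourierFactor_mul_fourierFactor (n e : ℕ) (z : ℂ) :
    fourierFactor e z * fourierFactor e (-z - n - 1) * (-1) ^ e = parityConst n e z := by
  have hpi : (Real.pi : ℂ) ≠ 0 := by exact_mod_cast Real.pi_ne_zero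
  have h1 : (Real.pi : ℂ) ^ (-(1 / 2) - z) * (Real.pi : ℂ) ^ (-(1 / 2) - (-z - n - 1)) =
      (Real.pi : ℂ) ^ n := by
    rw [← Complex.cpow_add _ _ hpi, ← Complex.cpow_natCast]
    congr 1
    ring
  have h2 : Complex.I ^ e * Complex.I ^ e * (-1) ^ e = 1 := by
    rw [← mul_pow, ← mul_pow, Complex.I_mul_I]
    norm_num
  have h3 : ((e : ℂ) - (-z - n - 1)) / 2 = (z + n + 1 + e) / 2 := by ring
  rw [fourierFactor, fourierFactor, parityConst, ← h1, h3]
  simp only [div_eq_mul_inv _ (Complex.Gamma _), div_eq_mul_inv _ (_ * Complex.Gamma _), mul_inv]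
  linear_combination (4 * ((Real.pi : ℂ) ^ (-(1 / 2) - z) *
    (Real.pi : ℂ) ^ (-(1 / 2) - (-z - n - 1))) * ((Complex.Gamma ((e - z) / 2))⁻¹ *
      (Complex.Gamma ((z + n + 1 + e) / 2))⁻¹)) * h2

theorem SchwartzMap.fourier_neg_of_parity (G : SchwartzMap (EuclideanSpace ℝ (Fin (n + 1))) ℂ)
    (hG : ∀ x, G (-x) = (-1) ^ e * G x) (y : EuclideanSpace ℝ (Fin (n + 1))) :
    𝓕 G (-y) = (-1) ^ e * 𝓕 G y := by
  rw [SchwartzMap.fourier_coe, Real.fourier_eq', Real.fourier_eq', ← integral_const_mul,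
    ← integral_neg_eq_self]
  refine integral_congr_ae (Eventually.of_forall fun x => ?_)
  simp only [hG, inner_neg_neg, smul_eq_mul]
  ring

theorem SchwartzMap.fourier_fourier_apply (G : SchwartzMap (EuclideanSpace ℝ (Fin (n + 1))) ℂ)
    (y : EuclideanSpace ℝ (Fin (n + 1))) : 𝓕 (𝓕 G) y = G (-y) := by
  have h : 𝓕⁻ (𝓕 G) = G := FourierTransform.fourierInv_fourier_eq G
  conv_rhs => rw [← h]
  rw [SchwartzMap.fourier_coe, SchwartzMap.fourierInv_coe, Real.fourierInv_eq_fourier_neg, neg_neg]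

/-- Polar coordinates for a Schwartz function that need not be a product of a radial and a spherical
factor; it is meant for `𝓕 G`. The Jacobian `r^n` and the homogeneity `r^z` give the exponent `z + n
+ 1`. -/
theorem SchwartzMap.integral_mul_parityKernel_eq_mellin
    (H : SchwartzMap (EuclideanSpace ℝ (Fin (n + 1))) ℂ) (e : ℕ) {z : ℂ} (hz : -1 < z.re)
    (hz' : z.re < 1) (ξ : UnitSphere n) :
    ∫ x, H x * parityKernel e z ⟪(ξ : EuclideanSpace ℝ (Fin (n + 1))), x⟫_ℝ =
      sphereIntegral n (parityKernel e)
        (fun η => mellin (fun s : ℝ => H (s • (η : EuclideanSpace ℝ (Fin (n + 1))))) (z + n + 1))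
        z ξ := by
  have hξ := norm_eq_of_mem_sphere ξ
  have hI : Integrable (fun x => H x * parityKernel e z
      ⟪(ξ : EuclideanSpace ℝ (Fin (n + 1))), x⟫_ℝ) := by
    refine ((H.integrable_mul_abs_inner_rpow hz hz' hξ).mul_const
      ‖(Complex.Gamma ((z + 1 + e) / 2))⁻¹‖).mono' ?_ ?_
    · exact (H.continuous.measurable.mul
        ((measurable_parityKernel e z).comp (by fun_prop))).aestronglyMeasurable
    · filter_upwards [ae_inner_ne_zero hξ] with x hx
      rw [parityKernel, div_eq_mul_inv, ← mul_assoc, norm_mul, norm_mul]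
      gcongr
      exact norm_rawKernel_le e z hx
  have hI2 := (integrable_iff_integrable_sphere_prod n _).1 hI
  rw [integral_eq_integral_sphere_prod, integral_prod _ hI2, sphereIntegral]
  refine integral_congr_ae (Eventually.of_forall fun η => ?_)
  simp only [inner_smul_right, sphereIntegrand]
  rw [integral_volumeIoiPow n (fun r => H (r • (η : EuclideanSpace ℝ (Fin (n + 1)))) *
    parityKernel e z (r * ⟪(ξ : EuclideanSpace ℝ (Fin (n + 1))),
      (η : EuclideanSpace ℝ (Fin (n + 1)))⟫_ℝ)), mellin, ← integral_mul_const]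
  refine setIntegral_congr_fun measurableSet_Ioi fun r hr => ?_
  have hr : 0 < r := hr
  have hr' : (r : ℂ) ≠ 0 := by exact_mod_cast hr.ne'
  simp only [parityKernel, rawKernel_mul e z hr, smul_eq_mul]
  rw [add_sub_cancel_right, Complex.cpow_add _ _ hr', Complex.cpow_natCast]
  ring

theorem mellin_ray_radialExtension (hf : SmoothOnSphere n f) (p w : ℂ) (η : UnitSphere n) :
    mellin (fun s : ℝ => hf.schwartz p (s • (η : EuclideanSpace ℝ (Fin (n + 1))))) w =
      mellin (fun r => (radialBump r : ℂ)) (w + p) * f η := by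
  rw [mellin, mellin, ← integral_mul_const]
  refine setIntegral_congr_fun measurableSet_Ioi fun s hs => ?_
  have hs : 0 < s := hs
  have hs' : (s : ℂ) ≠ 0 := by exact_mod_cast hs.ne'
  simp only [hf.schwartz_apply, radialExtension_smul p f hs, smul_eq_mul]
  rw [show w + p - 1 = (w - 1) + p by ring, Complex.cpow_add _ _ hs']
  ring

/-- The inversion formula in the strip where the outer integral converges absolutely. -/
theorem parityJ_parityJ_of_strip (he : e < 2) (hf : SmoothOnSphere n f)
    (hfe : ∀ η, f (-η) = (-1) ^ e * f η) {z : ℂ} (hz : -(n : ℝ) - 1 < z.re) (hz' : z.re < -(n : ℝ))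
    (ξ : UnitSphere n) :
    parityJ n e (-z - n - 1) (parityJ n e z f) ξ = parityConst n e z * f ξ := by
  have hn : (0 : ℝ) ≤ n := Nat.cast_nonneg n
  set μ : ℂ := -z - n - 1 with hμ
  have hμre : μ.re = -z.re - n - 1 := by simp [hμ]
  have hμ1 : -1 < μ.re := by rw [hμre]; linarith
  have hμ0 : μ.re < 0 := by rw [hμre]; linarith
  have hz0 : z.re < 0 := by linarith
  set p : ℂ := -z - n with hp
  have hM : radialMoment n p z ≠ 0 := radialMoment_ne_zero n z
  set G := hf.schwartz p
  have hG : ∀ x, G (-x) = (-1) ^ e * G x := radialExtension_neg hfe p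
  rw [parityJ_eq_sphereIntegral he (smoothOnSphere_parityJ he hf hfe z) (parityJ_neg he hf hfe z) hμ1]
  -- The Mellin exponent `-z` equals `μ + n + 1`, the one that polar coordinates attach to the
  -- kernel of degree `μ`; this is what singles out `μ`.
  have hφ : ∀ η : UnitSphere n, parityJ n e z f η = fourierFactor e z / radialMoment n p z *
      mellin (fun s : ℝ => 𝓕 G (s • (η : EuclideanSpace ℝ (Fin (n + 1))))) (μ + n + 1) := by
    intro η
    have h := radialMoment_mul_parityJ he hf hfe p hz0 η
    rw [fourierSide] at h
    rw [show μ + n + 1 = -z by rw [hμ]; ring, div_mul_eq_mul_div, eq_div_iff hM, ← h, mul_comm]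
  have h1 : sphereIntegral n (parityKernel e) (parityJ n e z f) μ ξ =
      fourierFactor e z / radialMoment n p z * sphereIntegral n (parityKernel e)
        (fun η => mellin (fun s : ℝ => 𝓕 G (s • (η : EuclideanSpace ℝ (Fin (n + 1)))))
          (μ + n + 1)) μ ξ := by
    rw [sphereIntegral, sphereIntegral, ← integral_const_mul]
    refine integral_congr_ae (Eventually.of_forall fun η => ?_)
    simp only [sphereIntegrand, hφ, mul_assoc]
  rw [h1, ← SchwartzMap.integral_mul_parityKernel_eq_mellin (𝓕 G) e hμ1 (by linarith) ξ,
    SchwartzMap.integral_mul_parityKernel he (𝓕 G) (G.fourier_neg_of_parity hG) (norm_eq_of_mem_sphere ξ)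
      hμ1 hμ0]
  -- The double Fourier transform returns `G` up to the sign of its parity. The moment that appears
  -- is the one in the denominator, since `-μ + p = p + z + n + 1`.
  have h2 : mellin (fun s : ℝ => 𝓕 (𝓕 G) (s • (ξ : EuclideanSpace ℝ (Fin (n + 1))))) (-μ) =
      (-1) ^ e * (radialMoment n p z * f ξ) := by
    simp only [SchwartzMap.fourier_fourier_apply, hG]
    have h3 := mellin_ray_radialExtension hf p (-μ) ξ
    rw [show -μ + p = p + z + n + 1 by rw [hμ]; ring] at h3
    rw [radialMoment, ← h3, ← smul_eq_mul ((-1 : ℂ) ^ e), ← mellin_const_smul]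
    rfl
  have h3 : fourierFactor e z * fourierFactor e μ * (-1) ^ e = parityConst n e z :=
    fourierFactor_mul_fourierFactor n e z
  rw [h2, ← h3]
  change fourierFactor e z / radialMoment n p z * (fourierFactor e μ * _) = _
  field_simp

theorem SmoothOnSphere.sub {f g : UnitSphere n → ℂ} (hf : SmoothOnSphere n f)
    (hg : SmoothOnSphere n g) : SmoothOnSphere n (f - g) :=
  ContMDiff.sub hf hg

theorem SmoothOnSphere.const_smul (hf : SmoothOnSphere n f) (c : ℂ) : SmoothOnSphere n (c • f) :=
  ((contDiff_const_smul c).contMDiff (n := ∞)).comp hf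

theorem SmoothOnSphere.star (hf : SmoothOnSphere n f) :
    SmoothOnSphere n (fun ξ => (starRingEnd ℂ) (f ξ)) :=
  (Complex.conjCLE.contDiff (n := ∞)).contMDiff.comp hf

/-- The inversion formula. -/
theorem parityJ_parityJ (he : e < 2) (hf : SmoothOnSphere n f)
    (hfe : ∀ η, f (-η) = (-1) ^ e * f η) (z : ℂ) :
    parityJ n e (-z - n - 1) (parityJ n e z f) = parityConst n e z • f := by
  -- In `J_μ (J_z f)` the function being transformed varies with `z` as well. By symmetry the outer
  -- transform is moved to the fixed `g`, and the pairing is visibly entire; the identity theorem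
  -- extends it from the strip.
  have hweak : ∀ g : UnitSphere n → ℂ, SmoothOnSphere n g → (∀ η, g (-η) = (-1) ^ e * g η) →
      ∫ ξ, parityJ n e z f ξ * parityJ n e (-z - n - 1) g ξ ∂(surfaceMeasure n) =
        parityConst n e z * ∫ ξ, f ξ * g ξ ∂(surfaceMeasure n) := by
    intro g hg hge
    have hd1 : Differentiable ℂ fun z =>
        ∫ ξ, parityJ n e z f ξ * parityJ n e (-z - n - 1) g ξ ∂(surfaceMeasure n) := by
      refine differentiable_integral_sphere (fun z => (smoothOnSphere_parityJ he hf hfe z).continuous.mul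
        (smoothOnSphere_parityJ he hg hge _).continuous) (fun ξ =>
          (differentiable_parityJ he hf hfe ξ).mul ((differentiable_parityJ he hg hge ξ).comp
            (by fun_prop : Differentiable ℂ fun z : ℂ => -z - n - 1))) fun w => ?_
      obtain ⟨A, hA⟩ := exists_bound_parityJ he hf hfe w
      obtain ⟨B, hB⟩ := exists_bound_parityJ he hg hge (-w - n - 1)
      have hB' := ((by fun_prop : Continuous fun z : ℂ => -z - n - 1).continuousAt
        (x := w)).eventually hB
      refine ⟨A * B, ?_⟩
      filter_upwards [hA, hB'] with u hu hu' ξ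
      rw [norm_mul]
      exact mul_le_mul (hu ξ) (hu' ξ) (norm_nonneg _) ((norm_nonneg _).trans (hu ξ))
    have hd2 : Differentiable ℂ fun z => parityConst n e z *
        ∫ ξ, f ξ * g ξ ∂(surfaceMeasure n) := (differentiable_parityConst n e).mul_const _
    refine (hd1.differentiableOn.analyticOnNhd isOpen_univ).eqOn_of_preconnected_of_eventuallyEq
      (hd2.differentiableOn.analyticOnNhd isOpen_univ) isPreconnected_univ
      (z₀ := -(n : ℂ) - 1 / 2) (mem_univ _) ?_ (mem_univ z)
    have h0 : ∀ᶠ w : ℂ in 𝓝 (-(n : ℂ) - 1 / 2), w.re ∈ Ioo (-(n : ℝ) - 1) (-(n : ℝ)) := by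
      refine Complex.continuous_re.continuousAt.preimage_mem_nhds (Ioo_mem_nhds ?_ ?_) <;>
        (simp; try norm_num)
    filter_upwards [h0] with w hw
    rw [← integral_parityJ_mul_eq he (smoothOnSphere_parityJ he hf hfe w) (parityJ_neg he hf hfe w)
      hg hge]
    simp only [parityJ_parityJ_of_strip he hf hfe hw.1 hw.2, mul_assoc, integral_const_mul]
  have hφ := smoothOnSphere_parityJ he hf hfe z
  have hφe := parityJ_neg he hf hfe z
  have hψ := smoothOnSphere_parityJ he hφ hφe (-z - n - 1)
  have hψe := parityJ_neg he hφ hφe (-z - n - 1)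
  set d : UnitSphere n → ℂ := parityJ n e (-z - n - 1) (parityJ n e z f) - parityConst n e z • f
    with hd
  have hds : SmoothOnSphere n d := hψ.sub (hf.const_smul _)
  have hde : ∀ η, d (-η) = (-1) ^ e * d η := by
    intro η
    simp only [hd, Pi.sub_apply, Pi.smul_apply, hψe, hfe, smul_eq_mul]
    ring
  have hge : ∀ η, (starRingEnd ℂ) (d (-η)) = (-1) ^ e * (starRingEnd ℂ) (d η) := by
    intro η; rw [hde]; simp
  -- The conjugate of the error `d` is an admissible test function, and it gives `∫ |d|² = 0`.
  have hw := hweak _ hds.star hge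
  rw [← integral_parityJ_mul_eq he hφ hφe hds.star hge] at hw
  have hint : ∀ {u v : UnitSphere n → ℂ}, Continuous u → Continuous v →
      Integrable (fun ξ => u ξ * v ξ) (surfaceMeasure n) := by
    intro u v hu hv
    exact (hu.mul hv).integrable_of_hasCompactSupport (HasCompactSupport.of_compactSpace _)
  have h0 : ∫ ξ, d ξ * (starRingEnd ℂ) (d ξ) ∂(surfaceMeasure n) = 0 := by
    calc _ = (∫ ξ, parityJ n e (-z - n - 1) (parityJ n e z f) ξ * (starRingEnd ℂ) (d ξ)
          ∂(surfaceMeasure n)) - ∫ ξ, parityConst n e z * (f ξ * (starRingEnd ℂ) (d ξ))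
          ∂(surfaceMeasure n) := by
          rw [← integral_sub (hint hψ.continuous hds.star.continuous)
            ((hint hf.continuous hds.star.continuous).const_mul _)]
          refine integral_congr_ae (Eventually.of_forall fun ξ => ?_)
          simp only [hd, Pi.sub_apply, Pi.smul_apply, smul_eq_mul]
          ring
      _ = 0 := by rw [hw, integral_const_mul, sub_self]
  have hdz : d = 0 := by
    simp only [Complex.mul_conj] at h0
    rw [integral_complex_ofReal, Complex.ofReal_eq_zero] at h0
    have hc : Continuous fun ξ => Complex.normSq (d ξ) :=
      Complex.continuous_normSq.comp hds.continuous
    rw [integral_eq_zero_iff_of_nonneg (fun ξ => Complex.normSq_nonneg _)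
      (hc.integrable_of_hasCompactSupport (HasCompactSupport.of_compactSpace _))] at h0
    -- Nonempty open sets have positive surface measure, so a continuous function that vanishes
    -- almost everywhere is zero.
    have h1 := (hc.ae_eq_iff_eq (surfaceMeasure n) continuous_const).1 h0
    funext ξ
    exact Complex.normSq_eq_zero.1 (congrFun h1 ξ)
  exact sub_eq_zero.1 hdz

/-! ### Specialization to the even and odd transforms. -/

theorem evenJ_eq_parityJ (n : ℕ) (z : ℂ) (f : UnitSphere n → ℂ) : evenJ n z f = parityJ n 0 z f := by
  rw [evenJ, evenKernel_eq_parityKernel, parityJ]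

theorem oddJ_eq_parityJ (n : ℕ) (z : ℂ) (f : UnitSphere n → ℂ) : oddJ n z f = parityJ n 1 z f := by
  rw [oddJ, oddKernel_eq_parityKernel, parityJ]

theorem evenConst_eq_parityConst (n : ℕ) (z : ℂ) : evenConst n z = parityConst n 0 z := by
  simp [evenConst, parityConst]

theorem oddConst_eq_parityConst (n : ℕ) (z : ℂ) : oddConst n z = parityConst n 1 z := by
  rw [oddConst, parityConst, Nat.cast_one, show z + n + 1 + 1 = z + n + 2 by ring]

/-- The constant can vanish only at poles of the Gamma factors, where `Complex.Gamma` has the value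
`0` and division by it gives `0`, in accordance with `1/Γ = 0`. -/
theorem parityConst_ne_zero {z : ℂ}
    (h : ∀ m : ℕ, z ≠ 2 * m + e ∧ -z - n - 1 ≠ 2 * m + e) : parityConst n e z ≠ 0 := by
  have hpi : (Real.pi : ℂ) ≠ 0 := by exact_mod_cast Real.pi_ne_zero
  have h1 : Complex.Gamma ((e - z) / 2) ≠ 0 := Complex.Gamma_ne_zero fun m hm =>
    (h m).1 (by linear_combination (-2 : ℂ) * hm)
  have h2 : Complex.Gamma ((z + n + 1 + e) / 2) ≠ 0 := Complex.Gamma_ne_zero fun m hm =>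
    (h m).2 (by linear_combination (-2 : ℂ) * hm)
  exact div_ne_zero (mul_ne_zero (by norm_num) (pow_ne_zero _ hpi)) (mul_ne_zero h1 h2)

/-- The continuation is a chosen function, so homogeneity in `f` has to come from uniqueness of the
continuation. -/
theorem parityJ_smul (he : e < 2) (hf : SmoothOnSphere n f)
    (hfe : ∀ η, f (-η) = (-1) ^ e * f η) (c z : ℂ) :
    parityJ n e z (c • f) = c • parityJ n e z f := by
  have hce : ∀ η, (c • f) (-η) = (-1) ^ e * (c • f) η := fun η => by
    simp only [Pi.smul_apply, hfe, smul_eq_mul]; ring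
  funext ξ
  refine congrFun (eq_of_differentiable_of_eqOn_re_gt (g := fun z => parityJ n e z (c • f) ξ)
    (h := fun z => c * parityJ n e z f ξ) (differentiable_parityJ he (hf.const_smul c) hce ξ)
    ((differentiable_parityJ he hf hfe ξ).const_mul _) fun z hz => ?_) z
  rw [parityJ_eq_sphereIntegral he (hf.const_smul c) hce hz, parityJ_eq_sphereIntegral he hf hfe hz,
    sphereIntegral, sphereIntegral, ← integral_const_mul]
  refine integral_congr_ae (Eventually.of_forall fun η => ?_)
  simp only [sphereIntegrand, Pi.smul_apply, smul_eq_mul]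
  ring

/-! ### Odd functions with the Gamma factor of the even case. -/

theorem mem_signedDomain_iff {z : ℂ} :
    z ∈ signedDomain ↔ (Complex.Gamma ((z + 2) / 2))⁻¹ ≠ 0 := by
  rw [ne_eq, inv_eq_zero, Complex.Gamma_eq_zero_iff, not_exists]
  refine forall_congr' fun m => not_congr ⟨fun h => ?_, fun h => ?_⟩
  · rw [h]; ring
  · linear_combination 2 * h

theorem isOpen_signedDomain : IsOpen signedDomain := by
  have h : signedDomain = {z | (Complex.Gamma ((z + 2) / 2))⁻¹ ≠ 0} := by
    ext z; exact mem_signedDomain_iff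
  rw [h]
  exact isOpen_ne_fun (Complex.differentiable_one_div_Gamma.continuous.comp (by fun_prop))
    continuous_const

/-- The complement of a countable set in a real vector space of dimension two is path connected.
Uniqueness of the continuation to this domain rests on it. -/
theorem isPreconnected_signedDomain : IsPreconnected signedDomain := by
  have h : signedDomain = (range fun m : ℕ => (-2 - 2 * (m : ℂ)))ᶜ := by
    ext z
    simp [signedDomain, eq_comm]
  rw [h]
  refine (Set.Countable.isPathConnected_compl_of_one_lt_rank ?_
    (countable_range _)).isConnected.isPreconnected
  rw [Complex.rank_real_complex]
  norm_num

theorem mem_signedDomain_of_neg_one_lt_re {z : ℂ} (hz : -1 < z.re) : z ∈ signedDomain := by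
  intro m hm
  have hm0 : (0 : ℝ) ≤ m := Nat.cast_nonneg m
  rw [hm] at hz
  simp at hz
  linarith

theorem differentiableOn_gammaRatio : DifferentiableOn ℂ gammaRatio signedDomain := by
  intro z hz
  have h1 : DifferentiableAt ℂ (fun z : ℂ => Complex.Gamma ((z + 2) / 2)) z := by
    refine DifferentiableAt.comp z (Complex.differentiableAt_Gamma _ fun m hm => hz m ?_)
      (by fun_prop : DifferentiableAt ℂ (fun z : ℂ => (z + 2) / 2) z)
    linear_combination 2 * hm
  have h2 : DifferentiableAt ℂ (fun z : ℂ => (Complex.Gamma ((z + 1) / 2))⁻¹) z :=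
    Complex.differentiable_one_div_Gamma.comp
      (by fun_prop : Differentiable ℂ fun z : ℂ => (z + 1) / 2) z
  exact (h1.mul h2).differentiableWithinAt

/-- The numerator `Γ((z+2)/2)` of the ratio cancels the denominator of the odd kernel, which is
legitimate off its poles. -/
theorem signedKernel_eq {z : ℂ} (hz : z ∈ signedDomain) (t : ℝ) :
    signedKernel z t = gammaRatio z * parityKernel 1 z t := by
  have h := inv_ne_zero (mem_signedDomain_iff.1 hz)
  rw [inv_inv] at h
  rw [← oddKernel_eq_parityKernel, signedKernel, oddKernel, gammaRatio]
  field_simp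

theorem sphereIntegrand_signedKernel {z : ℂ} (hz : z ∈ signedDomain) (f : UnitSphere n → ℂ)
    (ξ η : UnitSphere n) : sphereIntegrand n signedKernel f z ξ η =
      gammaRatio z * sphereIntegrand n (parityKernel 1) f z ξ η := by
  rw [sphereIntegrand, sphereIntegrand, signedKernel_eq hz]
  ring

theorem isContinuation_gammaRatio_mul (hf : SmoothOnSphere n f)
    (hfe : ∀ η, f (-η) = (-1) ^ 1 * f η) (ξ : UnitSphere n) :
    IsContinuation signedDomain (fun z => sphereIntegral n signedKernel f z ξ)
      (fun z => gammaRatio z * parityJ n 1 z f ξ) := by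
  refine ⟨differentiableOn_gammaRatio.mul
    (differentiable_parityJ one_lt_two hf hfe ξ).differentiableOn, fun z hz => ?_⟩
  simp only [parityJ_eq_sphereIntegral one_lt_two hf hfe hz, sphereIntegral,
    sphereIntegrand_signedKernel (mem_signedDomain_of_neg_one_lt_re hz), integral_const_mul]

theorem transformDefined_signedKernel (hf : SmoothOnSphere n f)
    (hfe : ∀ η, f (-η) = (-1) ^ 1 * f η) : TransformDefined n signedKernel signedDomain f := by
  refine fun ξ => ⟨fun z hz => ?_, isContinuation_continuation (isContinuation_gammaRatio_mul hf hfe ξ)⟩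
  refine ((integrable_sphereIntegrand_parityKernel 1 hf.continuous hz ξ).const_mul
    (gammaRatio z)).congr (Eventually.of_forall fun η => ?_)
  exact (sphereIntegrand_signedKernel (mem_signedDomain_of_neg_one_lt_re hz) f ξ η).symm

theorem signedJ_eq (hf : SmoothOnSphere n f) (hfe : ∀ η, f (-η) = (-1) ^ 1 * f η) {z : ℂ}
    (hz : z ∈ signedDomain) : signedJ n z f = gammaRatio z • parityJ n 1 z f := by
  funext ξ
  exact (transformDefined_signedKernel hf hfe ξ).2.eqOn isOpen_signedDomain
    isPreconnected_signedDomain (fun _ hw => mem_signedDomain_of_neg_one_lt_re hw)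
    (isContinuation_gammaRatio_mul hf hfe ξ) hz

/-- On the domain the ratio vanishes only at the poles of `Γ((z+1)/2)`, the negative odd integers.
-/
theorem gammaRatio_ne_zero {z : ℂ} (hz : z ∈ signedDomain) (h : ∀ k : ℤ, Odd k → z ≠ k) :
    gammaRatio z ≠ 0 := by
  have h1 := inv_ne_zero (mem_signedDomain_iff.1 hz)
  rw [inv_inv] at h1
  refine div_ne_zero h1 (Complex.Gamma_ne_zero fun m hm => ?_)
  refine h (-2 * m - 1) ⟨-m - 1, by ring⟩ ?_
  push_cast
  linear_combination 2 * hm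

theorem eq_inv_smul_of_eq_smul {c : ℂ} (hc : c ≠ 0) {g : UnitSphere n → ℂ} (h : g = c • f) :
    f = c⁻¹ • g := by
  rw [h, smul_smul, inv_mul_cancel₀ hc, one_smul]

theorem mainTheorem4 (n : ℕ) :
    -- even functions
    (∀ f : UnitSphere n → ℂ, SmoothOnSphere n f → Function.Even f →
      TransformDefined n evenKernel Set.univ f ∧
      ∀ z : ℂ, ∀ φ : UnitSphere n → ℂ, φ = evenJ n z f →
        SmoothOnSphere n φ ∧ Function.Even φ ∧
        evenJ n (-z - n - 1) φ = evenConst n z • f ∧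
        ((∀ m : ℕ, z ≠ 2 * m ∧ -z - n - 1 ≠ 2 * m) →
          f = (evenConst n z)⁻¹ • evenJ n (-z - n - 1) φ)) ∧
    -- odd functions
    (∀ f : UnitSphere n → ℂ, SmoothOnSphere n f → Function.Odd f →
      TransformDefined n oddKernel Set.univ f ∧
      ∀ z : ℂ, ∀ φ : UnitSphere n → ℂ, φ = oddJ n z f →
        SmoothOnSphere n φ ∧ Function.Odd φ ∧
        oddJ n (-z - n - 1) φ = oddConst n z • f ∧
        ((∀ m : ℕ, z ≠ 2 * m + 1 ∧ -z - n - 1 ≠ 2 * m + 1) →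
          f = (oddConst n z)⁻¹ • oddJ n (-z - n - 1) φ)) ∧
    -- odd functions, with the Gamma factor of the even kernel
    (∀ f : UnitSphere n → ℂ, SmoothOnSphere n f → Function.Odd f →
      TransformDefined n signedKernel signedDomain f ∧
      ∀ z ∈ signedDomain, ∀ φ : UnitSphere n → ℂ, φ = signedJ n z f →
        SmoothOnSphere n φ ∧ Function.Odd φ ∧
        (-z - n - 1 ∈ signedDomain →
          signedJ n (-z - n - 1) φ =
            (gammaRatio z * gammaRatio (-z - n - 1) * oddConst n z) • f ∧
          ((∀ k : ℤ, Odd k → z ≠ k ∧ -z - n - 1 ≠ k) →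
            f = (gammaRatio z * gammaRatio (-z - n - 1) * oddConst n z)⁻¹ •
              signedJ n (-z - n - 1) φ))) := by
  refine ⟨fun f hf hev => ?_, fun f hf hodd => ?_, fun f hf hodd => ?_⟩
  · have hfe : ∀ η, f (-η) = (-1) ^ 0 * f η := fun η => by rw [hev η]; simp
    refine ⟨evenKernel_eq_parityKernel ▸ transformDefined_parityKernel two_pos hf hfe, ?_⟩
    rintro z _ rfl
    simp only [evenJ_eq_parityJ, evenConst_eq_parityConst]
    have hinv := parityJ_parityJ two_pos hf hfe z
    refine ⟨smoothOnSphere_parityJ two_pos hf hfe z, fun ξ => ?_, hinv, fun h => ?_⟩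
    · simpa using parityJ_neg two_pos hf hfe z ξ
    · exact eq_inv_smul_of_eq_smul (parityConst_ne_zero (by simpa using h)) hinv
  · have hfe : ∀ η, f (-η) = (-1) ^ 1 * f η := fun η => by rw [hodd η]; simp
    refine ⟨oddKernel_eq_parityKernel ▸ transformDefined_parityKernel one_lt_two hf hfe, ?_⟩
    rintro z _ rfl
    simp only [oddJ_eq_parityJ, oddConst_eq_parityConst]
    have hinv := parityJ_parityJ one_lt_two hf hfe z
    refine ⟨smoothOnSphere_parityJ one_lt_two hf hfe z, fun ξ => ?_, hinv, fun h => ?_⟩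
    · simpa using parityJ_neg one_lt_two hf hfe z ξ
    · exact eq_inv_smul_of_eq_smul (parityConst_ne_zero (by simpa using h)) hinv
  · have hfe : ∀ η, f (-η) = (-1) ^ 1 * f η := fun η => by rw [hodd η]; simp
    refine ⟨transformDefined_signedKernel hf hfe, ?_⟩
    rintro z hz _ rfl
    rw [signedJ_eq hf hfe hz]
    have hs := smoothOnSphere_parityJ one_lt_two hf hfe z
    have hse := parityJ_neg one_lt_two hf hfe z
    have hce : ∀ η, (gammaRatio z • parityJ n 1 z f) (-η) =
        (-1) ^ 1 * (gammaRatio z • parityJ n 1 z f) η := fun η => by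
      simp only [Pi.smul_apply, hse, smul_eq_mul]; ring
    refine ⟨hs.const_smul _, fun ξ => ?_, fun hμ => ?_⟩
    · simpa using hce ξ
    have hinv : signedJ n (-z - n - 1) (gammaRatio z • parityJ n 1 z f) =
        (gammaRatio z * gammaRatio (-z - n - 1) * oddConst n z) • f := by
      rw [signedJ_eq (hs.const_smul _) hce hμ, parityJ_smul one_lt_two hs hse,
        parityJ_parityJ one_lt_two hf hfe, oddConst_eq_parityConst, smul_smul, smul_smul]
      ring_nf
    refine ⟨hinv, fun h => eq_inv_smul_of_eq_smul ?_ hinv⟩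
    refine mul_ne_zero (mul_ne_zero (gammaRatio_ne_zero hz fun k hk => (h k hk).1)
      (gammaRatio_ne_zero hμ fun k hk => (h k hk).2)) ?_
    rw [oddConst_eq_parityConst]
    refine parityConst_ne_zero fun m => ?_
    -- Negative odd integers are excluded for the sake of the two Gamma ratios; the positive ones
    -- are those at which the odd constant vanishes.
    have hm := h (2 * m + 1) ⟨m, rfl⟩
    push_cast at hm ⊢
    exact hm
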